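/- **Setting.** $S$ is a finite set of states, $Y$ a set of prizes, $\Delta(Y)$ the set of lotteries (probabilities with finite support) on $Y$; acts are functions $f:S\to\Delta(Y)$, mixed statewise; $l^*$ is the constant act with value $l$; $fEh$ is the act equal to $f$ on $E\subseteq S$ and to $h$ off $E$; $MEh=\{fEh: f\in M\}$, $pM+(1-p)h=\{pf+(1-p)h: f\in M\}$. Fix any collection $\mathcal M$ of nonempty sets of acts, called menus, that contains all finite nonempty sets of acts and contains $M\cup M'$, $pM+(1-p)h$ and $MEk$ for all $M,M'\in\mathcal M$, $0<p<1$, acts $h$, $E\subseteq S$ and $k\in M$. A weighted set of probabilities $\mathcal P^+$ on $S$ is a set of pairs $(\Pr,\alpha_{\Pr})$, $\Pr$ a probability on $S$, $\alpha_{\Pr}\in[0,1]$, with exactly one weight for each $\Pr$ that occurs and $\alpha_{\Pr}=1$ for some $\Pr$. Let $\overline{\mathcal P}^+(E)=\sup_{\Pr}\alpha_{\Pr}\Pr(E)$. If this is positive, $\mathcal P^+\mid E$ is the set of pairs $(\Pr\mid E,\alpha_{\Pr,E})$ with $\Pr(E)>0$, where $\alpha_{\Pr,E}=\sup\{\alpha_{\Pr'}\Pr'(E)/\overline{\mathcal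 P}^+(E):\Pr'\mid E=\Pr\mid E\}$. $C(\mathcal P^+)=\{\alpha\Pr: 0\le\alpha\le\alpha_{\Pr}\}$; such a set is regular if it is convex, closed and downward closed (among nonnegative vectors of $\mathbb R^S$). For $U:Y\to\mathbb R$ let $u(l)=\sum_y l(y)U(y)$. The MWER preference for $(U,\mathcal P^+)$ is: $f\succeq_M g$ iff $\mathrm{reg}_M(f)\le\mathrm{reg}_M(g)$, where $$\mathrm{reg}_M(f)=\sup_{(\Pr,\alpha_{\Pr})\in\mathcal P^+}\alpha_{\Pr}\sum_{s}\Pr(s)\Bigl(\sup_{g\in M}u(g(s))-u(f(s))\Bigr).$$ **Axioms** for a family $\succeq_M$, $M\in\mathcal M$ (with $M,M'\in\mathcal M$, compared acts in the menu, $p\in(0,1)$; $l^*\succeq l'^*$ without menu refers to $\{l^*,l'^*\}$). (1) $\succeq_M$ is transitive. (2) It is complete. (3) $f\succ_M g$ for some $f,g,M$. (4) If $(f(s))^*\succeq(g(s))^*$ for all $s$, then $f\succeq_M g$. (5) If $f\succ_M g\succ_M h$, there are $q,r\in(0,1)$ with $qf+(1-q)h\succ_{M\cup\{qf+(1-q)h\}}g\succ_{M\cup\{rf+(1-r)h\}}rf+(1-r)h$.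 (6) If $f\sim_M g$ then $pf+(1-p)g\succeq_{M\cup\{pf+(1-p)g\}}g$. (7) $f\succeq_M g$ iff $pf+(1-p)h\succeq_{pM+(1-p)h}pg+(1-p)h$, for every act $h$. (8) $l^*\succeq_M l'^*$ iff $l^*\succeq_{M'}l'^*$. (9) If for every $h\in M'$ and every $s$ there is $k\in M$ with $(k(s))^*\succeq(h(s))^*$, then $f\succeq_M g$ iff $f\succeq_{M\cup M'}g$. (10) For every $M$ there is a lottery $\bar l$ with $\bar l^*\succeq(f(s))^*$ for all $f\in M$, $s\in S$. (9$'$), the limit form of (9): the conclusion of (9) holds whenever for every $h\in M'$, every $s$ and every lottery $l$, if $l^*\succeq(k(s))^*$ for all $k\in M$ then $l^*\succeq(h(s))^*$. (It coincides with (9) for menus $M$ that have a best outcome in each state.) For a family $\succeq_{E,M}$ ($E\subseteq S$, $M\in\mathcal M$) write $\succeq_M$ for $\succeq_{S,M}$. An event $E$ is null if $fEg\sim_M g$ for all acts $f,g$ and all $M\in\mathcal M$ containing $fEg$ and $g$. **MDC**: for every non-null $E$, every menu $M$ and all $f,g\in M$, $f\succeq_{E,M}g$ iff $fEh\succeq_{MEh}gEh$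 for some $h\in M$. **Theorem.** (a) Let $U$ be nonconstant, let $\mathcal P^+$ be a weighted set of probabilities on $S$, and suppose that for every $M\in\mathcal M$ there is a lottery $l$ with $u(f(s))\le u(l)$ for all $f\in M$, $s\in S$. For the family $\succeq_{E,M}$ of MWER preferences with respect to $\mathcal P^+\mid E$: an event $E$ is non-null iff $\overline{\mathcal P}^+(E)>0$; for each such $E$ the family $(\succeq_{E,M})_M$ satisfies Axioms 1–10 and (9$'$); MDC holds; and $\succeq_{S,M}$ is the MWER preference with respect to $\mathcal P^+$ itself. (b) Conversely, let $\succeq_{E,M}$ be a family that satisfies Axioms 1–10 for $E=S$ and for every non-null $E$, and MDC. Suppose that every menu has a best outcome in each state (for every $M\in\mathcal M$ and $s$ there is $f\in M$ with $(f(s))^*\succeq(g(s))^*$ for all $g\in M$), or that (9$'$) holds for $\succeq_{S,M}$. Then there are $U:Y\to\mathbb R$ and a weighted set of probabilities $\mathcal P^+$ on $S$ with $C(\mathcal P^+)$ regular that represent the family: for every $M\in\mathcal M$ there is a lottery $l$ with $u(f(s))\le u(l)$ for all $f\in M$, $s\in S$ (so regrets are finite), and, for every non-null $E$, $\overline{\mathcal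 P}^+(E)>0$ and, for every $M\in\mathcal M$, $\succeq_{E,M}$ is on $M$ the MWER preference for $(U,\mathcal P^+\mid E)$. For $a>0$ and $b\in\mathbb R$, $(aU+b,\mathcal P^+)$ also represents it; and if $(V,\mathcal Q^+)$ represents it, then $V=aU+b$ for some $a>0$, $b\in\mathbb R$, and if moreover $C(\mathcal Q^+)$ is regular, then $C(\mathcal Q^+)=C(\mathcal P^+)$. -/

import Mathlib

open Set

noncomputable section

namespace MWER

/-! ### Lotteries, acts, menus -/

/-- Lotteries over the prizes `Y`: finitely supported probability distributions. -/
abbrev Lottery (Y : Type*) := Convexity.StdSimplex ℝ Y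

/-- Anscombe–Aumann acts: functions from states to lotteries. -/
abbrev Act (S Y : Type*) := S → Lottery Y

/-- A family of binary relations on acts indexed by menus: `R M f g` reads `f ⪰_M g`.
Only the values with `M` a menu and `f, g ∈ M` are ever used. -/
abbrev MenuPref (S Y : Type*) := Set (Act S Y) → Act S Y → Act S Y → Prop

/-- The same, indexed also by the information `E`: `R E M f g` reads `f ⪰_{E,M} g`.
Unconditional preferences are those conditional on `Set.univ`. -/
abbrev CondPref (S Y : Type*) := Set S → MenuPref S Y

variable {S Y : Type*}

/-- The mixture `p l + (1 - p) l'` of two lotteries. -/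
def mixLottery (p : unitInterval) (l l' : Lottery Y) : Lottery Y :=
  Convexity.convexCombPair (p : ℝ) (1 - (p : ℝ)) p.2.1 (sub_nonneg.2 p.2.2) (by ring) l l'

/-- The statewise mixture `p f + (1 - p) g` of two acts. -/
def mix (p : unitInterval) (f g : Act S Y) : Act S Y := fun s => mixLottery p (f s) (g s)

/-- The menu `p M + (1 - p) h`. -/
def mixMenu (p : unitInterval) (M : Set (Act S Y)) (h : Act S Y) : Set (Act S Y) :=
  (fun f => mix p f h) '' M

/-- The constant act `l*`. -/
def const (l : Lottery Y) : Act S Y := fun _ => l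

open Classical in
/-- The act `f E h`, equal to `f` on `E` and to `h` off `E`. -/
def splice (f : Act S Y) (E : Set S) (h : Act S Y) : Act S Y := fun s => if s ∈ E then f s else h s

/-- The menu `M E h`. -/
def spliceMenu (M : Set (Act S Y)) (E : Set S) (h : Act S Y) : Set (Act S Y) :=
  (fun f => splice f E h) '' M

/-- A collection of menus: nonempty sets of acts, among them all finite ones, such that the
menus formed in the axioms are again in the collection. -/
structure IsMenuCollection (𝓜 : Set (Set (Act S Y))) : Prop where
  nonempty : ∀ M ∈ 𝓜, M.Nonempty
  finite : ∀ M : Set (Act S Y), M.Finite → M.Nonempty → M ∈ 𝓜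
  union : ∀ M ∈ 𝓜, ∀ M' ∈ 𝓜, M ∪ M' ∈ 𝓜
  mixture : ∀ M ∈ 𝓜, ∀ (h : Act S Y) (p : unitInterval), 0 < p → p < 1 → mixMenu p M h ∈ 𝓜
  splice : ∀ M ∈ 𝓜, ∀ (E : Set S), ∀ h ∈ M, spliceMenu M E h ∈ 𝓜

/-! ### The axioms -/

/-- `f ≻_M g`. -/
def Strict (R : MenuPref S Y) (M : Set (Act S Y)) (f g : Act S Y) : Prop := R M f g ∧ ¬ R M g f

/-- `f ∼_M g`. -/
def Indiff (R : MenuPref S Y) (M : Set (Act S Y)) (f g : Act S Y) : Prop := R M f g ∧ R M g f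

/-- `l* ⪰ l'*`, the comparison of two constant acts in the menu that they form. -/
def ConstPref (R : MenuPref S Y) (l l' : Lottery Y) : Prop :=
  R {const l, const l'} (const l) (const l')

/-- `h` is never strictly optimal relative to `M`. -/
def NeverStrictlyOptimal (R : MenuPref S Y) (M : Set (Act S Y)) (h : Act S Y) : Prop :=
  ∀ s, ∃ f ∈ M, ConstPref R (f s) (h s)

/-- Axioms 1–10 for the family `⪰_M`, `M ∈ 𝓜`. -/
structure Axioms (𝓜 : Set (Set (Act S Y))) (R : MenuPref S Y) : Prop where
  transitivity : ∀ M ∈ 𝓜, ∀ f ∈ M, ∀ g ∈ M, ∀ h ∈ M, R M f g → R M g h → R M f h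
  completeness : ∀ M ∈ 𝓜, ∀ f ∈ M, ∀ g ∈ M, R M f g ∨ R M g f
  nontriviality : ∃ M ∈ 𝓜, ∃ f ∈ M, ∃ g ∈ M, Strict R M f g
  monotonicity : ∀ M ∈ 𝓜, ∀ f ∈ M, ∀ g ∈ M, (∀ s, ConstPref R (f s) (g s)) → R M f g
  mixture_continuity : ∀ M ∈ 𝓜, ∀ f ∈ M, ∀ g ∈ M, ∀ h ∈ M, Strict R M f g → Strict R M g h →
    ∃ q r : unitInterval, (0 < q ∧ q < 1) ∧ (0 < r ∧ r < 1) ∧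
      Strict R (M ∪ {mix q f h}) (mix q f h) g ∧ Strict R (M ∪ {mix r f h}) g (mix r f h)
  ambiguity_aversion : ∀ M ∈ 𝓜, ∀ f ∈ M, ∀ g ∈ M, ∀ p : unitInterval, 0 < p → p < 1 →
    Indiff R M f g → R (M ∪ {mix p f g}) (mix p f g) g
  independence : ∀ M ∈ 𝓜, ∀ f ∈ M, ∀ g ∈ M, ∀ (h : Act S Y) (p : unitInterval), 0 < p → p < 1 →
    (R M f g ↔ R (mixMenu p M h) (mix p f h) (mix p g h))
  menu_independence_const : ∀ M ∈ 𝓜, ∀ M' ∈ 𝓜, ∀ l l' : Lottery Y,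
    const l ∈ M → const l' ∈ M → const l ∈ M' → const l' ∈ M' →
    (R M (const l) (const l') ↔ R M' (const l) (const l'))
  ina : ∀ M ∈ 𝓜, ∀ M' ∈ 𝓜, (∀ h ∈ M', NeverStrictlyOptimal R M h) →
    ∀ f ∈ M, ∀ g ∈ M, (R M f g ↔ R (M ∪ M') f g)
  boundedness : ∀ M ∈ 𝓜, ∃ l : Lottery Y, ∀ f ∈ M, ∀ s, ConstPref R l (f s)

/-- In every state some act of `M` yields an outcome that is best among those of `M`. -/
def HasBestOutcomes (R : MenuPref S Y) (M : Set (Act S Y)) : Prop :=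
  ∀ s, ∃ f ∈ M, ∀ g ∈ M, ConstPref R (f s) (g s)

/-- `h` never exceeds the (possibly unattained) supremum of `M`: in every state, `h` is no better
than any lottery that bounds the outcomes of `M` from above. -/
def NeverAboveSup (R : MenuPref S Y) (M : Set (Act S Y)) (h : Act S Y) : Prop :=
  ∀ s, ∀ l : Lottery Y, (∀ f ∈ M, ConstPref R l (f s)) → ConstPref R l (h s)

/-- Independence of never strictly optimal alternatives in its limit form. For menus with best
outcomes in every state it is the same as the axiom `Axioms.ina`. -/
def LimitINA (𝓜 : Set (Set (Act S Y))) (R : MenuPref S Y) : Prop :=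
  ∀ M ∈ 𝓜, ∀ M' ∈ 𝓜, (∀ h ∈ M', NeverAboveSup R M h) →
    ∀ f ∈ M, ∀ g ∈ M, (R M f g ↔ R (M ∪ M') f g)

/-- `E` is non-null for the unconditional preferences `R`. -/
def NonNull (𝓜 : Set (Set (Act S Y))) (R : MenuPref S Y) (E : Set S) : Prop :=
  ¬ ∀ f g : Act S Y, ∀ M ∈ 𝓜, splice f E g ∈ M → g ∈ M → Indiff R M (splice f E g) g

/-- Menu-dependent dynamic consistency. -/
def MDC (𝓜 : Set (Set (Act S Y))) (R : CondPref S Y) : Prop :=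
  ∀ E : Set S, NonNull 𝓜 (R univ) E → ∀ M ∈ 𝓜, ∀ f ∈ M, ∀ g ∈ M,
    (R E M f g ↔ ∃ h ∈ M, R univ (spliceMenu M E h) (splice f E h) (splice g E h))

/-! ### Weighted sets of probabilities and regret -/

variable [Fintype S]

/-- `P` is a weighted set of probabilities on `S`: a set of pairs `(Pr, α)` with `α ∈ [0, 1]`, with
one weight for each probability that occurs, and with weight `1` occurring. -/
structure IsWeightedSet (P : Set ((S → ℝ) × ℝ)) : Prop where
  prob : ∀ x ∈ P, x.1 ∈ stdSimplex ℝ S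
  weight : ∀ x ∈ P, x.2 ∈ Icc (0 : ℝ) 1
  unique : ∀ x ∈ P, ∀ y ∈ P, x.1 = y.1 → x.2 = y.2
  normalized : ∃ x ∈ P, x.2 = 1

/-- `Pr(E)`. -/
def prob (p : S → ℝ) (E : Set S) : ℝ := ∑ s, E.indicator p s

/-- The conditional probability `Pr | E`. -/
def cond (p : S → ℝ) (E : Set S) : S → ℝ := fun s => E.indicator p s / prob p E

/-- `sup {α_Pr Pr(E)}`, the upper weighted likelihood of `E`. -/
def upperLik (P : Set ((S → ℝ) × ℝ)) (E : Set S) : ℝ := sSup ((fun x => x.2 * prob x.1 E) '' P)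

/-- The weight of `Pr | E` after likelihood updating (meaningful if `Pr(E) > 0`). -/
def updWeight (P : Set ((S → ℝ) × ℝ)) (E : Set S) (p : S → ℝ) : ℝ :=
  sSup ((fun x => x.2 * prob x.1 E / upperLik P E) ''
    {x | x ∈ P ∧ 0 < prob x.1 E ∧ cond x.1 E = cond p E})

/-- Likelihood updating `P⁺ | E` (meaningful if `upperLik P E > 0`); only the probabilities with
`Pr(E) > 0` can be conditioned on `E`. -/
def update (P : Set ((S → ℝ) × ℝ)) (E : Set S) : Set ((S → ℝ) × ℝ) :=
  (fun x => (cond x.1 E, updWeight P E x.1)) '' {x | x ∈ P ∧ 0 < prob x.1 E}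

/-- The set of sub-probability measures `C(P⁺)`. -/
def subProbs (P : Set ((S → ℝ) × ℝ)) : Set (S → ℝ) :=
  {q | ∃ x ∈ P, ∃ a : ℝ, 0 ≤ a ∧ a ≤ x.2 ∧ q = a • x.1}

/-- Regular sets of sub-probability measures: convex, closed and downward closed. -/
structure IsRegular (C : Set (S → ℝ)) : Prop where
  convex : Convex ℝ C
  closed : IsClosed C
  downward : ∀ p ∈ C, ∀ q : S → ℝ, 0 ≤ q → q ≤ p → q ∈ C

/-- The expected utility `u(l)` of a lottery. -/
def util (U : Y → ℝ) (l : Lottery Y) : ℝ := l.weights.sum fun y a => a * U y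

/-- The regret of `f` in state `s` with respect to the menu `M`. -/
def regret (U : Y → ℝ) (M : Set (Act S Y)) (f : Act S Y) (s : S) : ℝ :=
  sSup ((fun g : Act S Y => util U (g s)) '' M) - util U (f s)

/-- The maximum weighted expected regret of `f` with respect to the menu `M`. -/
def weightedRegret (U : Y → ℝ) (P : Set ((S → ℝ) × ℝ)) (M : Set (Act S Y)) (f : Act S Y) : ℝ :=
  sSup ((fun x => x.2 * ∑ s, x.1 s * regret U M f s) '' P)

/-- The MWER preferences. -/
def mwerPref (U : Y → ℝ) (P : Set ((S → ℝ) × ℝ)) : MenuPref S Y :=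
  fun M f g => weightedRegret U P M f ≤ weightedRegret U P M g

/-- The MWER preferences with likelihood updating. -/
def mwerCondPref (U : Y → ℝ) (P : Set ((S → ℝ) × ℝ)) : CondPref S Y :=
  fun E => mwerPref U (update P E)

/-- The utilities of every menu are bounded from above, by the utility of some lottery. -/
def MenusBounded (𝓜 : Set (Set (Act S Y))) (U : Y → ℝ) : Prop :=
  ∀ M ∈ 𝓜, ∃ l : Lottery Y, ∀ f ∈ M, ∀ s, util U (f s) ≤ util U l

/-- `(U, P⁺)` represents the family `⪰_{E,M}`: regrets are finite, and for every non-null `E` the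
update `P⁺ | E` is defined and `⪰_{E,M}` is MWER with respect to it, for every menu `M`. -/
structure Represents (𝓜 : Set (Set (Act S Y))) (R : CondPref S Y) (U : Y → ℝ)
    (P : Set ((S → ℝ) × ℝ)) : Prop where
  bounded : MenusBounded 𝓜 U
  pref : ∀ E : Set S, NonNull 𝓜 (R univ) E → 0 < upperLik P E ∧
    ∀ M ∈ 𝓜, ∀ f ∈ M, ∀ g ∈ M, (R E M f g ↔ mwerPref U (update P E) M f g)

end MWER

end

noncomputable section

namespace MWER

section

variable {S Y : Type*}

/-! ### Utilities of mixtures -/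

/-! A menu enters only through the statewise suprema of utility, so an act is judged by its regret
vector, and MWER minimizes `upperExp P`, a monotone, positively homogeneous, subadditive functional
of nonnegative vectors (`IsUpperExpectation`). The axioms hold for every such functional N
(`MinimizesRegret.axioms`): mixing a menu with an act scales regrets, and adding acts that do not
exceed the suprema leaves them alone. Splicing with E multiplies regrets by the indicator of E,
while likelihood updating replaces N(v) by N(1_E v)/N(1_E) (`upperExp_update`); hence dynamic
consistency.

Conversely, the preferences between constant acts satisfy the von Neumann–Morgenstern axioms and
yield U (`IsVNM.exists_util`). Independence, INA and monotonicity make preferences depend only on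
the direction of the pair of regret vectors (`congr_regret`), which gives a preorder on nonnegative
vectors (`isRegretOrder`). By continuity each vector is equivalent to a unique constant N(v), and
ambiguity aversion makes N subadditive (`exists_upperExpectation`). By Hahn–Banach, N is the support
function of the sub-probabilities that it dominates; the largest admissible multiple of each
probability is its weight (`exists_weightedSet`). Dynamic consistency then determines the
conditional preferences (`MDC.represents`).

For uniqueness, U is affinely unique as a von Neumann–Morgenstern utility, N(v) is read off from the
constant vector equivalent to v (`eq_of_one`), and separation recovers a regular C(P) from its
support function (`subProbs_eq_dominated`). -/

lemma util_eq_linearCombination (U : Y → ℝ) (l : Lottery Y) :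
    util U l = Finsupp.linearCombination ℝ U l.weights := by
  simp [util, Finsupp.linearCombination_apply]

lemma weights_mixLottery (p : unitInterval) (l l' : Lottery Y) :
    (mixLottery p l l').weights = (p : ℝ) • l.weights + (1 - (p : ℝ)) • l'.weights := by
  simp [mixLottery]

@[simp]
lemma util_mixLottery (U : Y → ℝ) (p : unitInterval) (l l' : Lottery Y) :
    util U (mixLottery p l l') = p * util U l + (1 - p) * util U l' := by
  simp [util_eq_linearCombination, weights_mixLottery]

@[simp]
lemma util_mix (U : Y → ℝ) (p : unitInterval) (f g : Act S Y) (s : S) :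
    util U (mix p f g s) = p * util U (f s) + (1 - p) * util U (g s) :=
  util_mixLottery ..

@[simp]
lemma const_apply (l : Lottery Y) (s : S) : const l s = l := rfl

@[simp]
lemma util_single (U : Y → ℝ) (y : Y) :
    util U (Convexity.StdSimplex.single y) = U y := by
  simp [util_eq_linearCombination]

lemma mix_const (p : unitInterval) (l l' : Lottery Y) :
    mix p (const l : Act S Y) (const l') = const (mixLottery p l l') := rfl

/-- Utility is affine along the segment of mixtures, so it takes all intermediate values. This
supplies lotteries of prescribed utility throughout. -/
lemma exists_util_eq {U : Y → ℝ} {l l' : Lottery Y} {t : ℝ} (h : util U l ≤ t)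
    (h' : t ≤ util U l') : ∃ m, util U m = t := by
  rcases h.eq_or_lt with h | h
  · exact ⟨l, h⟩
  have hd : 0 < util U l' - util U l := by linarith
  refine ⟨mixLottery ⟨(t - util U l) / (util U l' - util U l), by
    constructor
    · exact div_nonneg (by linarith) hd.le
    · rw [div_le_one hd]; linarith⟩ l' l, ?_⟩
  rw [util_mixLottery]
  simp only
  field_simp
  ring

lemma util_affine (U : Y → ℝ) (a b : ℝ) (l : Lottery Y) :
    util (fun y => a * U y + b) l = a * util U l + b := by
  have h : (fun y => a * U y + b) = a • U + b • fun _ => (1 : ℝ) := by ext; simp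
  have h1 : Finsupp.linearCombination ℝ (fun _ : Y => (1 : ℝ)) l.weights = 1 := by
    simp [Finsupp.linearCombination_apply]
  have key : ∀ w : Y →₀ ℝ, Finsupp.linearCombination ℝ (a • U + b • fun _ => (1 : ℝ)) w =
      a * Finsupp.linearCombination ℝ U w +
        b * Finsupp.linearCombination ℝ (fun _ : Y => (1 : ℝ)) w := by
    intro w
    simp only [Finsupp.linearCombination_apply, Finsupp.sum, Finset.mul_sum,
      ← Finset.sum_add_distrib]
    refine Finset.sum_congr rfl fun y _ => ?_
    simp
    ring
  rw [util_eq_linearCombination, util_eq_linearCombination, h, key, h1, mul_one]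

lemma exists_util_lt {U : Y → ℝ} (hU : ∃ y₁ y₂, U y₁ ≠ U y₂) :
    ∃ l l' : Lottery Y, util U l < util U l' := by
  obtain ⟨y₁, y₂, h⟩ := hU
  rcases lt_or_gt_of_ne h with h | h
  · exact ⟨.single y₁, .single y₂, by simp [h]⟩
  · exact ⟨.single y₂, .single y₁, by simp [h]⟩

/-! ### Regrets -/

/-- The utilities that the acts of `M` yield in each state are bounded from above. -/
def UtilBounded (U : Y → ℝ) (M : Set (Act S Y)) : Prop :=
  ∀ s, BddAbove ((fun g : Act S Y => util U (g s)) '' M)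

lemma MenusBounded.utilBounded {𝓜 : Set (Set (Act S Y))} {U : Y → ℝ} (h : MenusBounded 𝓜 U)
    {M : Set (Act S Y)} (hM : M ∈ 𝓜) : UtilBounded U M := by
  obtain ⟨l, hl⟩ := h M hM
  rintro s
  exact ⟨util U l, by rintro _ ⟨f, hf, rfl⟩; exact hl f hf s⟩

lemma UtilBounded.isLUB {U : Y → ℝ} {M : Set (Act S Y)} (h : UtilBounded U M) (hM : M.Nonempty)
    (s : S) : IsLUB ((fun g : Act S Y => util U (g s)) '' M)
      (sSup ((fun g : Act S Y => util U (g s)) '' M)) :=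
  isLUB_csSup (hM.image _) (h s)

lemma regret_eq_of_isLUB {U : Y → ℝ} {M : Set (Act S Y)} {s : S} {a : ℝ} (hM : M.Nonempty)
    (h : IsLUB ((fun g : Act S Y => util U (g s)) '' M) a) (f : Act S Y) :
    regret U M f s = a - util U (f s) := by
  rw [regret, h.csSup_eq (hM.image _)]

lemma regret_eq_of_top {U : Y → ℝ} {M : Set (Act S Y)} {k : Act S Y} (hk : k ∈ M)
    (h : ∀ g ∈ M, ∀ s, util U (g s) ≤ util U (k s)) (f : Act S Y) (s : S) :
    regret U M f s = util U (k s) - util U (f s) := by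
  refine regret_eq_of_isLUB ⟨k, hk⟩ (IsGreatest.isLUB ⟨⟨k, hk, rfl⟩, ?_⟩) f
  rintro _ ⟨g, hg, rfl⟩
  exact h g hg s

lemma regret_nonneg {U : Y → ℝ} {M : Set (Act S Y)} (h : UtilBounded U M) {f : Act S Y}
    (hf : f ∈ M) : 0 ≤ regret U M f :=
  fun s => sub_nonneg.2 (le_csSup (h s) ⟨f, hf, rfl⟩)

lemma regret_mono {U : Y → ℝ} (M : Set (Act S Y)) {f g : Act S Y}
    (h : ∀ s, util U (g s) ≤ util U (f s)) : regret U M f ≤ regret U M g :=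
  fun s => sub_le_sub_left (h s) _

/-- Acts that stay below the statewise suprema do not move them. Both forms of INA rest on this. -/
lemma regret_union {U : Y → ℝ} {M M' : Set (Act S Y)} (h : UtilBounded U M) (hM : M.Nonempty)
    (h' : ∀ g ∈ M', ∀ s, util U (g s) ≤ sSup ((fun g : Act S Y => util U (g s)) '' M))
    (f : Act S Y) : regret U (M ∪ M') f = regret U M f := by
  funext s
  refine regret_eq_of_isLUB (hM.mono subset_union_left) ⟨?_, fun b hb => ?_⟩ f
  · rintro _ ⟨g, hg | hg, rfl⟩
    · exact le_csSup (h s) ⟨g, hg, rfl⟩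
    · exact h' g hg s
  · exact csSup_le (hM.image _) fun x hx => hb (image_mono subset_union_left hx)

/-- The supremum a becomes p a + (1 - p) u(g), and the contribution of g cancels in the difference.
-/
lemma regret_mixMenu {U : Y → ℝ} {M : Set (Act S Y)} (h : UtilBounded U M) (hM : M.Nonempty)
    (g : Act S Y) {p : unitInterval} (hp : 0 < p) (f : Act S Y) :
    regret U (mixMenu p M g) (mix p f g) = (p : ℝ) • regret U M f := by
  have hp' : (0 : ℝ) < p := hp
  funext s
  have hl := h.isLUB hM s
  set a := sSup ((fun g : Act S Y => util U (g s)) '' M) with ha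
  have : IsLUB ((fun k : Act S Y => util U (k s)) '' mixMenu p M g)
      (p * a + (1 - p) * util U (g s)) := by
    constructor
    · rintro _ ⟨_, ⟨k, hk, rfl⟩, rfl⟩
      have := mul_le_mul_of_nonneg_left (hl.1 ⟨k, hk, rfl⟩) hp'.le
      simpa using this
    · intro b hb
      have : a ≤ (b - (1 - p) * util U (g s)) / p := by
        refine hl.2 ?_
        rintro _ ⟨k, hk, rfl⟩
        have := hb ⟨mix p k g, ⟨k, hk, rfl⟩, rfl⟩
        simp only [util_mix] at this
        rw [le_div_iff₀ hp']
        linarith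
      rw [le_div_iff₀ hp'] at this
      linarith
  have hne : (mixMenu p M g).Nonempty := hM.image _
  rw [regret_eq_of_isLUB hne this, Pi.smul_apply, regret, ← ha, util_mix, smul_eq_mul]
  ring

/-- Off E all acts of the spliced menu coincide with h, so nothing is regretted there. The result
does not involve h, which makes the choice of h in MDC immaterial. -/
lemma regret_spliceMenu {U : Y → ℝ} {M : Set (Act S Y)} (hM : M.Nonempty) (E : Set S)
    (h f : Act S Y) :
    regret U (spliceMenu M E h) (splice f E h) = E.indicator (regret U M f) := by
  funext s
  by_cases hs : s ∈ E
  · simp only [regret, spliceMenu, image_image, splice, hs, if_true, indicator_of_mem]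
  · simp only [regret, spliceMenu, image_image, splice, hs, if_false, not_false_eq_true,
      indicator_of_notMem, hM.image_const, csSup_singleton, sub_self]

lemma regret_affine {U : Y → ℝ} {M : Set (Act S Y)} (h : UtilBounded U M) (hM : M.Nonempty)
    {a : ℝ} (ha : 0 < a) (b : ℝ) (f : Act S Y) :
    regret (fun y => a * U y + b) M f = a • regret U M f := by
  funext s
  have hl := h.isLUB hM s
  set c := sSup ((fun g : Act S Y => util U (g s)) '' M) with hc
  have : IsLUB ((fun k : Act S Y => util (fun y => a * U y + b) (k s)) '' M) (a * c + b) := by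
    constructor
    · rintro _ ⟨k, hk, rfl⟩
      have := mul_le_mul_of_nonneg_left (hl.1 ⟨k, hk, rfl⟩) ha.le
      simpa [util_affine] using this
    · intro d hd
      have : c ≤ (d - b) / a := by
        refine hl.2 ?_
        rintro _ ⟨k, hk, rfl⟩
        have := hd ⟨k, hk, rfl⟩
        simp only [util_affine] at this
        rw [le_div_iff₀ ha]
        linarith
      rw [le_div_iff₀ ha] at this
      linarith
  rw [regret_eq_of_isLUB hM this, Pi.smul_apply, regret, ← hc, util_affine, smul_eq_mul]
  ring

/-- The regret vector of a mixture that does not change the best outcomes. -/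
lemma regret_mix {U : Y → ℝ} {M : Set (Act S Y)} (h : UtilBounded U M) {f g : Act S Y}
    (hf : f ∈ M) (hg : g ∈ M) (p : unitInterval) :
    regret U (M ∪ {mix p f g}) (mix p f g) =
      (p : ℝ) • regret U M f + (1 - p : ℝ) • regret U M g := by
  have hp := p.2
  rw [regret_union h ⟨f, hf⟩]
  · funext s
    simp only [regret, util_mix, Pi.add_apply, Pi.smul_apply, smul_eq_mul]
    ring
  · rintro _ rfl s
    have h1 := le_csSup (h s) ⟨f, hf, rfl⟩
    have h2 := le_csSup (h s) ⟨g, hg, rfl⟩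
    rw [util_mix]
    nlinarith [mul_le_mul_of_nonneg_left h1 hp.1,
      mul_le_mul_of_nonneg_left h2 (sub_nonneg.2 hp.2)]

end

section

variable {S Y : Type*}

/-! ### Upper expectations -/

lemma indicator_nonneg_vec (E : Set S) {v : S → ℝ} (hv : 0 ≤ v) : 0 ≤ E.indicator v :=
  fun s => indicator_nonneg (fun s _ => hv s) s

/-- Monotone sublinear functionals on the nonnegative vectors, not vanishing at the constant `1`. -/
structure IsUpperExpectation (N : (S → ℝ) → ℝ) : Prop where
  mono : ∀ v w, 0 ≤ v → v ≤ w → N v ≤ N w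
  add_le : ∀ v w, 0 ≤ v → 0 ≤ w → N (v + w) ≤ N v + N w
  smul : ∀ (c : ℝ) v, 0 ≤ c → 0 ≤ v → N (c • v) = c * N v
  one_pos : 0 < N 1

namespace IsUpperExpectation

variable {N : (S → ℝ) → ℝ} (hN : IsUpperExpectation N)
include hN

lemma zero : N 0 = 0 := by simpa using hN.smul 0 0 le_rfl le_rfl

lemma nonneg {v : S → ℝ} (hv : 0 ≤ v) : 0 ≤ N v := hN.zero ▸ hN.mono 0 v le_rfl hv

/-- Strictness in the constant direction, which separates constant acts of different utility. -/
lemma lt_add_smul_one {v : S → ℝ} [Finite S] (hv : 0 ≤ v) {d : ℝ} (hd : 0 < d) :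
    N v < N (v + d • 1) := by
  obtain ⟨K, hK⟩ := (finite_range v).bddAbove
  have hK' : ∀ s, v s ≤ max K 0 := fun s => (hK ⟨s, rfl⟩).trans (le_max_left _ _)
  set k := max K 0 with hk
  have hk0 : 0 ≤ k := le_max_right _ _
  have h1 : (0 : S → ℝ) ≤ d • 1 := fun s => by simpa using hd.le
  have h2 : 0 < N (v + d • 1) := by
    refine lt_of_lt_of_le ?_ (hN.mono (d • 1) _ h1 (le_add_of_nonneg_left hv))
    rw [hN.smul _ _ hd.le zero_le_one]
    exact mul_pos hd hN.one_pos
  -- Since v ≤ k, v is at most the fraction k / (k + d) < 1 of v + d, and homogeneity applies.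
  have h3 : N v ≤ k / (k + d) * N (v + d • 1) := by
    rw [← hN.smul _ _ (by positivity) (add_nonneg hv h1)]
    refine hN.mono _ _ hv fun s => ?_
    simp only [Pi.smul_apply, Pi.add_apply, Pi.one_apply, smul_eq_mul, mul_one]
    rw [div_mul_eq_mul_div, le_div_iff₀ (by positivity)]
    nlinarith [hK' s]
  refine h3.trans_lt ?_
  have : k / (k + d) < 1 := by rw [div_lt_one (by positivity)]; linarith
  nlinarith

/-- This is the shape that N takes after an update on E. -/
lemma indicator {E : Set S} (hE : 0 < N (E.indicator 1)) {c : ℝ} (hc : 0 < c) :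
    IsUpperExpectation fun v => N (E.indicator v) / c where
  mono v w hv h := by
    have := hN.mono (E.indicator v) (E.indicator w)
      (indicator_nonneg_vec E hv) (fun s => indicator_le_indicator (h s))
    gcongr
  add_le v w hv hw := by
    rw [← add_div]
    have := hN.add_le (E.indicator v) (E.indicator w)
      (indicator_nonneg_vec E hv)
      (indicator_nonneg_vec E hw)
    rw [← indicator_add'] at this
    gcongr
  smul a v ha hv := by
    have := hN.smul a (E.indicator v) ha (indicator_nonneg_vec E hv)
    rw [← mul_div_assoc, ← this]
    congr 2
    funext s
    by_cases hs : s ∈ E <;> simp [hs]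
  one_pos := div_pos hE hc

lemma indicator_eq_zero [Finite S] {E : Set S} (hE : N (E.indicator 1) = 0) {v : S → ℝ}
    (hv : 0 ≤ v) : N (E.indicator v) = 0 := by
  obtain ⟨K, hK⟩ := (finite_range v).bddAbove
  have hK' : ∀ s, v s ≤ max K 0 := fun s => (hK ⟨s, rfl⟩).trans (le_max_left _ _)
  refine le_antisymm ?_ (hN.nonneg (indicator_nonneg_vec E hv))
  have h := hN.mono (E.indicator v) (max K 0 • E.indicator 1)
    (indicator_nonneg_vec E hv) fun s => by
      by_cases hs : s ∈ E
      · simpa [hs] using hK' s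
      · simp [hs]
  rwa [hN.smul _ _ (le_max_right _ _) (indicator_nonneg_vec E zero_le_one), hE,
    mul_zero] at h

/-- Vectors that agree off an event of zero upper probability have the same upper expectation. -/
lemma eq_of_indicator_compl_eq [Finite S] {E : Set S} (hE : N (E.indicator 1) = 0) {v w : S → ℝ}
    (hv : 0 ≤ v) (hw : 0 ≤ w) (h : ∀ s ∉ E, v s = w s) : N v = N w := by
  have key : ∀ v : S → ℝ, 0 ≤ v → N v = N (Eᶜ.indicator v) := by
    intro v hv
    have h1 : (0 : S → ℝ) ≤ E.indicator v := indicator_nonneg_vec E hv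
    have h2 : (0 : S → ℝ) ≤ Eᶜ.indicator v := indicator_nonneg_vec _ hv
    apply le_antisymm
    · have := hN.add_le _ _ h1 h2
      rwa [indicator_self_add_compl, hN.indicator_eq_zero hE hv, zero_add] at this
    · exact hN.mono _ _ h2 (indicator_le_self' fun s _ => hv s)
  rw [key v hv, key w hw]
  congr 1
  funext s
  by_cases hs : s ∈ E
  · simp [hs]
  · simp [hs, h s hs]

end IsUpperExpectation

/-! ### Weighted sets of probabilities as upper expectations -/

variable [Fintype S]

/-- The maximum weighted expectation of `v` over `P`. -/
def upperExp (P : Set ((S → ℝ) × ℝ)) (v : S → ℝ) : ℝ :=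
  sSup ((fun x => x.2 * ∑ s, x.1 s * v s) '' P)

lemma weightedRegret_eq (U : Y → ℝ) (P : Set ((S → ℝ) × ℝ)) (M : Set (Act S Y)) (f : Act S Y) :
    weightedRegret U P M f = upperExp P (regret U M f) := rfl

lemma prob_eq_sum_mul (p : S → ℝ) (E : Set S) :
    prob p E = ∑ s, p s * E.indicator (1 : S → ℝ) s := by
  refine Finset.sum_congr rfl fun s _ => ?_
  by_cases hs : s ∈ E <;> simp [hs]

lemma upperLik_eq (P : Set ((S → ℝ) × ℝ)) (E : Set S) :
    upperLik P E = upperExp P (E.indicator 1) := by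
  simp only [upperLik, upperExp, prob_eq_sum_mul]

namespace IsWeightedSet

variable {P : Set ((S → ℝ) × ℝ)} (hP : IsWeightedSet P)
include hP

lemma nonempty : P.Nonempty := by
  obtain ⟨x, hx, -⟩ := hP.normalized
  exact ⟨x, hx⟩

lemma sum_nonneg {x : (S → ℝ) × ℝ} (hx : x ∈ P) {v : S → ℝ} (hv : 0 ≤ v) :
    0 ≤ ∑ s, x.1 s * v s :=
  Finset.sum_nonneg fun s _ => mul_nonneg ((hP.prob x hx).1 s) (hv s)

lemma bddAbove {v : S → ℝ} (hv : 0 ≤ v) :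
    BddAbove ((fun x : (S → ℝ) × ℝ => x.2 * ∑ s, x.1 s * v s) '' P) := by
  refine ⟨∑ s, v s, ?_⟩
  rintro _ ⟨x, hx, rfl⟩
  calc x.2 * ∑ s, x.1 s * v s ≤ 1 * ∑ s, x.1 s * v s :=
        mul_le_mul_of_nonneg_right (hP.weight x hx).2 (hP.sum_nonneg hx hv)
    _ = ∑ s, x.1 s * v s := one_mul _
    _ ≤ ∑ s, v s := Finset.sum_le_sum fun s _ => by
        have := (mem_Icc_of_mem_stdSimplex (hP.prob x hx) s).2
        nlinarith [hv s, show (0 : ℝ) ≤ v s from hv s]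

lemma le_upperExp {v : S → ℝ} (hv : 0 ≤ v) {x : (S → ℝ) × ℝ} (hx : x ∈ P) :
    x.2 * ∑ s, x.1 s * v s ≤ upperExp P v :=
  le_csSup (hP.bddAbove hv) ⟨x, hx, rfl⟩

lemma upperExp_le {v : S → ℝ} {a : ℝ} (h : ∀ x ∈ P, x.2 * ∑ s, x.1 s * v s ≤ a) :
    upperExp P v ≤ a :=
  csSup_le (hP.nonempty.image _) (by rintro _ ⟨x, hx, rfl⟩; exact h x hx)

lemma upperExp_one : upperExp P 1 = 1 := by
  apply le_antisymm
  · refine hP.upperExp_le fun x hx => ?_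
    simpa [(hP.prob x hx).2] using (hP.weight x hx).2
  · obtain ⟨x, hx, h⟩ := hP.normalized
    simpa [(hP.prob x hx).2, h] using hP.le_upperExp (v := 1) zero_le_one hx

lemma isUpperExpectation : IsUpperExpectation (upperExp P) where
  mono v w hv h := hP.upperExp_le fun x hx => le_trans
    (mul_le_mul_of_nonneg_left (Finset.sum_le_sum fun s _ =>
      mul_le_mul_of_nonneg_left (h s) ((hP.prob x hx).1 s)) (hP.weight x hx).1)
    (hP.le_upperExp (hv.trans h) hx)
  add_le v w hv hw := hP.upperExp_le fun x hx => by
    have h1 := hP.le_upperExp hv hx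
    have h2 := hP.le_upperExp hw hx
    simp only [Pi.add_apply, mul_add, Finset.sum_add_distrib]
    linarith
  smul c v hc hv := by
    rw [upperExp, upperExp, ← smul_eq_mul, ← Real.sSup_smul_of_nonneg hc, ← image_smul, image_image]
    congr 2
    funext x
    simp only [Pi.smul_apply, smul_eq_mul, Finset.mul_sum]
    exact Finset.sum_congr rfl fun s _ => by ring
  one_pos := by simp [hP.upperExp_one]

omit hP in
lemma sum_cond_mul (p : S → ℝ) (E : Set S) (v : S → ℝ) :
    ∑ s, cond p E s * v s = (∑ s, p s * E.indicator v s) / MWER.prob p E := by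
  rw [Finset.sum_div]
  refine Finset.sum_congr rfl fun s _ => ?_
  by_cases hs : s ∈ E <;> simp [cond, hs, div_mul_eq_mul_div]

lemma prob_nonneg {x : (S → ℝ) × ℝ} (hx : x ∈ P) (E : Set S) : 0 ≤ MWER.prob x.1 E :=
  Finset.sum_nonneg fun s _ => indicator_nonneg (fun s _ => (hP.prob x hx).1 s) s

lemma mul_prob_le_upperLik {x : (S → ℝ) × ℝ} (hx : x ∈ P) (E : Set S) :
    x.2 * MWER.prob x.1 E ≤ upperLik P E := by
  rw [upperLik_eq, prob_eq_sum_mul]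
  exact hP.le_upperExp (fun s => indicator_nonneg (fun _ _ => zero_le_one) s) hx

/-- Likelihood updating restricts the upper expectation to `E` and normalizes it. -/
lemma upperExp_update {E : Set S} (hE : 0 < upperLik P E) {v : S → ℝ} (hv : 0 ≤ v) :
    upperExp (update P E) v = upperExp P (E.indicator v) / upperLik P E := by
  have hv' : (0 : S → ℝ) ≤ E.indicator v := indicator_nonneg_vec E hv
  have hbdd : ∀ p : S → ℝ, BddAbove ((fun x : (S → ℝ) × ℝ => x.2 * MWER.prob x.1 E / upperLik P E) ''
      {x | x ∈ P ∧ 0 < MWER.prob x.1 E ∧ cond x.1 E = cond p E}) := by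
    intro p
    refine ⟨1, ?_⟩
    rintro _ ⟨x, ⟨hx, -, -⟩, rfl⟩
    exact div_le_one_of_le₀ (hP.mul_prob_le_upperLik hx E) hE.le
  -- An updated weight is a supremum over all probabilities with the same conditional; for each of
  -- them Pr'(E) cancels between the weight and the conditional expectation.
  have hle : ∀ y ∈ update P E,
      y.2 * ∑ s, y.1 s * v s ≤ upperExp P (E.indicator v) / upperLik P E := by
    rintro _ ⟨x, ⟨hx, hxE⟩, rfl⟩
    have hs : 0 ≤ ∑ s, cond x.1 E s * v s := by
      rw [sum_cond_mul]
      exact div_nonneg (hP.sum_nonneg hx hv') hxE.le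
    simp only
    rcases hs.eq_or_lt with h0 | h0
    · rw [← h0, mul_zero]
      exact div_nonneg (hP.isUpperExpectation.nonneg hv') hE.le
    rw [← le_div_iff₀ h0]
    refine csSup_le ⟨_, x, ⟨hx, hxE, rfl⟩, rfl⟩ ?_
    rintro _ ⟨x', ⟨hx', hxE', hc⟩, rfl⟩
    simp only
    rw [le_div_iff₀ h0, ← hc, sum_cond_mul, div_mul_div_comm, mul_right_comm,
      mul_div_mul_right _ _ hxE'.ne']
    gcongr
    exact hP.le_upperExp hv' hx'
  apply le_antisymm
  -- With `sSup ∅ = 0`, a nonnegative bound suffices and the update need not be known to be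
  -- nonempty.
  · refine Real.sSup_le ?_ (div_nonneg (hP.isUpperExpectation.nonneg hv') hE.le)
    rintro _ ⟨y, hy, rfl⟩
    exact hle y hy
  · rw [div_le_iff₀ hE]
    refine hP.upperExp_le fun x hx => ?_
    have hb : BddAbove ((fun x : (S → ℝ) × ℝ => x.2 * ∑ s, x.1 s * v s) '' update P E) := by
      refine ⟨upperExp P (E.indicator v) / upperLik P E, ?_⟩
      rintro _ ⟨y, hy, rfl⟩
      exact hle y hy
    rcases (hP.prob_nonneg hx E).eq_or_lt with h0 | h0
    -- A probability with Pr(E) = 0 has no counterpart in the update, but its expectation of 1_E v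
    -- vanishes.
    · have : ∑ s, x.1 s * E.indicator v s = 0 := by
        refine Finset.sum_eq_zero fun s _ => ?_
        by_cases hs : s ∈ E
        · have := (Finset.sum_eq_zero_iff_of_nonneg (fun s _ =>
            indicator_nonneg (fun s _ => (hP.prob x hx).1 s) s)).1 h0.symm s (Finset.mem_univ s)
          simp only [hs, indicator_of_mem] at this
          simp [this]
        · simp [hs]
      rw [this, mul_zero]
      refine mul_nonneg (Real.sSup_nonneg ?_) hE.le
      rintro _ ⟨_, ⟨x, ⟨hx, hxE⟩, rfl⟩, rfl⟩
      refine mul_nonneg (Real.sSup_nonneg ?_) ?_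
      · rintro _ ⟨x', ⟨hx', hxE', hc⟩, rfl⟩
        exact div_nonneg (mul_nonneg (hP.weight x' hx').1 hxE'.le) hE.le
      · rw [sum_cond_mul]
        exact div_nonneg (hP.sum_nonneg hx hv') hxE.le
    · have h1 : updWeight P E x.1 * ∑ s, cond x.1 E s * v s ≤ upperExp (update P E) v :=
        le_csSup hb ⟨_, ⟨x, ⟨hx, h0⟩, rfl⟩, rfl⟩
      have h2 : x.2 * MWER.prob x.1 E / upperLik P E ≤ updWeight P E x.1 :=
        le_csSup (hbdd x.1) ⟨x, ⟨hx, h0, rfl⟩, rfl⟩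
      have h3 := (mul_le_mul_of_nonneg_right h2 (by
        rw [sum_cond_mul]
        exact div_nonneg (hP.sum_nonneg hx hv') h0.le)).trans h1
      rw [sum_cond_mul, div_mul_div_comm, mul_right_comm, mul_div_mul_right _ _ h0.ne',
        div_le_iff₀ hE] at h3
      exact h3

lemma upperLik_univ : upperLik P univ = 1 := by
  rw [upperLik_eq, indicator_univ, hP.upperExp_one]

/-- The upper expectation of the update `P | E`. -/
lemma isUpperExpectation_update {E : Set S} (hE : 0 < upperLik P E) :
    IsUpperExpectation fun v => upperExp P (E.indicator v) / upperLik P E :=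
  hP.isUpperExpectation.indicator (by rwa [← upperLik_eq]) hE

end IsWeightedSet

end

section

variable {S Y : Type*}

/-! ### Regret minimization satisfies the axioms -/

/-- `R` minimizes the upper expectation `N` of the regret, on the menus of `𝓜`. -/
def MinimizesRegret (𝓜 : Set (Set (Act S Y))) (R : MenuPref S Y) (U : Y → ℝ)
    (N : (S → ℝ) → ℝ) : Prop :=
  ∀ M ∈ 𝓜, ∀ f ∈ M, ∀ g ∈ M, (R M f g ↔ N (regret U M f) ≤ N (regret U M g))

namespace MinimizesRegret

variable {𝓜 : Set (Set (Act S Y))} {R : MenuPref S Y} {U : Y → ℝ} {N : (S → ℝ) → ℝ}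
  (hR : MinimizesRegret 𝓜 R U N)
include hR

lemma strict_iff {M : Set (Act S Y)} (hM : M ∈ 𝓜) {f g : Act S Y} (hf : f ∈ M) (hg : g ∈ M) :
    Strict R M f g ↔ N (regret U M f) < N (regret U M g) := by
  rw [Strict, hR M hM f hf g hg, hR M hM g hg f hf, lt_iff_le_not_ge]

lemma indiff_iff {M : Set (Act S Y)} (hM : M ∈ 𝓜) {f g : Act S Y} (hf : f ∈ M) (hg : g ∈ M) :
    Indiff R M f g ↔ N (regret U M f) = N (regret U M g) := by
  rw [Indiff, hR M hM f hf g hg, hR M hM g hg f hf, le_antisymm_iff]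

variable [Finite S] (hN : IsUpperExpectation N) (h𝓜 : IsMenuCollection 𝓜)
include hN

/-- The regrets of two constant acts differ by a multiple of the vector 1, whatever the menu. -/
lemma const_iff {M : Set (Act S Y)} (hM : M ∈ 𝓜) (hb : UtilBounded U M) {l l' : Lottery Y}
    (hl : const l ∈ M) (hl' : const l' ∈ M) :
    R M (const l) (const l') ↔ util U l' ≤ util U l := by
  rw [hR M hM _ hl _ hl']
  constructor
  · intro h
    by_contra hlt
    push Not at hlt
    refine h.not_gt ?_
    have h1 := hN.lt_add_smul_one (regret_nonneg hb hl') (sub_pos.2 hlt)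
    have h2 : regret U M (const l) = regret U M (const l') + (util U l' - util U l) • 1 := by
      funext s
      simp [regret]
    rwa [h2]
  · exact fun h => hN.mono _ _ (regret_nonneg hb hl) (regret_mono M fun s => h)

include h𝓜

omit hR hN [Finite S] in
lemma _root_.MWER.IsMenuCollection.pair_mem (f g : Act S Y) : {f, g} ∈ 𝓜 :=
  h𝓜.finite _ (toFinite _) ⟨f, by simp⟩

omit hR hN [Finite S] h𝓜 in
lemma _root_.MWER.UtilBounded.of_finite {M : Set (Act S Y)} (hM : M.Finite) (U : Y → ℝ) :
    UtilBounded U M := fun _ => (hM.image _).bddAbove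

lemma constPref_iff (l l' : Lottery Y) : ConstPref R l l' ↔ util U l' ≤ util U l :=
  hR.const_iff hN (h𝓜.pair_mem _ _) (.of_finite (toFinite _) U) (by simp) (by simp)

omit hR hN [Finite S] in
lemma _root_.MWER.IsMenuCollection.insert_mem {M : Set (Act S Y)} (hM : M ∈ 𝓜) (f : Act S Y) :
    M ∪ {f} ∈ 𝓜 :=
  h𝓜.union _ hM _ (h𝓜.finite _ (toFinite _) ⟨f, by simp⟩)

lemma limitINA (hB : MenusBounded 𝓜 U) : LimitINA 𝓜 R := by
  intro M hM M' hM' h f hf g hg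
  have hb := hB.utilBounded hM
  have key : ∀ k ∈ M', ∀ s, util U (k s) ≤ sSup ((fun g : Act S Y => util U (g s)) '' M) := by
    intro k hk s
    -- Otherwise some lottery has utility exactly the supremum: it bounds M in state s but not k.
    by_contra! hlt
    obtain ⟨l, hl⟩ := exists_util_eq (le_csSup (hb s) ⟨f, hf, rfl⟩) hlt.le
    have h1 := h k hk s l fun e he => by
      rw [hR.constPref_iff hN h𝓜, hl]
      exact le_csSup (hb s) ⟨e, he, rfl⟩
    rw [hR.constPref_iff hN h𝓜, hl] at h1
    exact h1.not_gt hlt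
  rw [hR M hM f hf g hg, hR _ (h𝓜.union M hM M' hM') f (.inl hf) g (.inl hg),
    regret_union hb ⟨f, hf⟩ key, regret_union hb ⟨f, hf⟩ key]

lemma axioms (hU : ∃ y₁ y₂, U y₁ ≠ U y₂) (hB : MenusBounded 𝓜 U) : Axioms 𝓜 R where
  transitivity M hM f hf g hg h hh := by
    rw [hR M hM f hf g hg, hR M hM g hg h hh, hR M hM f hf h hh]
    exact le_trans
  completeness M hM f hf g hg := by
    rw [hR M hM f hf g hg, hR M hM g hg f hf]
    exact le_total _ _
  nontriviality := by
    obtain ⟨l, l', h⟩ := exists_util_lt hU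
    have hM := h𝓜.pair_mem (const l' : Act S Y) (const l)
    refine ⟨_, hM, const l', by simp, const l, by simp, ?_⟩
    have hb := hB.utilBounded hM
    rw [Strict, hR.const_iff hN hM hb (by simp) (by simp),
      hR.const_iff hN hM hb (by simp) (by simp)]
    exact ⟨h.le, h.not_ge⟩
  monotonicity M hM f hf g hg h := by
    rw [hR M hM f hf g hg]
    exact hN.mono _ _ (regret_nonneg (hB.utilBounded hM) hf)
      (regret_mono M fun s => (hR.constPref_iff hN h𝓜 _ _).1 (h s))
  mixture_continuity M hM f hf g hg h hh hfg hgh := by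
    have hb := hB.utilBounded hM
    rw [hR.strict_iff hM hf hg] at hfg
    rw [hR.strict_iff hM hg hh] at hgh
    have hf0 := regret_nonneg hb hf
    have hg0 := regret_nonneg hb hg
    have hh0 := regret_nonneg hb hh
    set a := N (regret U M f) with ha
    set b := N (regret U M g) with hbdef
    set c := N (regret U M h) with hc
    have ha0 : 0 ≤ a := hN.nonneg hf0
    have hk : ∀ p : unitInterval,
        regret U (M ∪ {mix p f h}) g = regret U M g := by
      intro p
      refine regret_union hb ⟨f, hf⟩ ?_ g
      rintro _ rfl s
      have h1 := le_csSup (hb s) ⟨f, hf, rfl⟩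
      have h2 := le_csSup (hb s) ⟨h, hh, rfl⟩
      rw [util_mix]
      nlinarith [mul_le_mul_of_nonneg_left h1 p.2.1,
        mul_le_mul_of_nonneg_left h2 (sub_nonneg.2 p.2.2)]
    have hden : 0 < 2 * (c - a) := by linarith
    have hcpos : 0 < 2 * c := by linarith
    -- weights for which the mixed regret stays on the required side of `b`
    refine ⟨⟨1 - (b - a) / (2 * (c - a)), ?_⟩, ⟨(c - b) / (2 * c), ?_⟩, ?_, ?_, ?_, ?_⟩
    · have h1 : (b - a) / (2 * (c - a)) ≤ 1 := by rw [div_le_one hden]; linarith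
      have h2 : 0 ≤ (b - a) / (2 * (c - a)) := div_nonneg (by linarith) hden.le
      constructor <;> linarith
    · exact ⟨div_nonneg (by linarith) hcpos.le, by rw [div_le_one hcpos]; linarith⟩
    · have h1 : (b - a) / (2 * (c - a)) < 1 := by rw [div_lt_one hden]; linarith
      have h2 : 0 < (b - a) / (2 * (c - a)) := div_pos (by linarith) hden
      constructor <;> rw [← Subtype.coe_lt_coe] <;> simp only [Icc.coe_zero, Icc.coe_one] <;>
        linarith
    · have h1 : (c - b) / (2 * c) < 1 := by rw [div_lt_one hcpos]; linarith
      have h2 : 0 < (c - b) / (2 * c) := div_pos (by linarith) hcpos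
      constructor <;> rw [← Subtype.coe_lt_coe] <;> simp only [Icc.coe_zero, Icc.coe_one] <;>
        linarith
    · rw [hR.strict_iff (h𝓜.insert_mem hM _) (.inr rfl) (.inl hg), regret_mix hb hf hh, hk]
      set t := (b - a) / (2 * (c - a)) with ht
      have h1 : t < 1 := by rw [ht, div_lt_one hden]; linarith
      have h2 : 0 ≤ t := div_nonneg (by linarith) hden.le
      simp only [sub_sub_cancel]
      -- The bound (1 - t) a + t c is the midpoint of a and b, hence below b.
      refine (hN.add_le _ _ (smul_nonneg (by linarith) hf0) (smul_nonneg h2 hh0)).trans_lt ?_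
      rw [hN.smul _ _ (by linarith) hf0, hN.smul _ _ h2 hh0]
      have : t * (2 * (c - a)) = b - a := div_mul_cancel₀ _ hden.ne'
      nlinarith
    · rw [hR.strict_iff (h𝓜.insert_mem hM _) (.inl hg) (.inr rfl), regret_mix hb hf hh, hk]
      set t := (c - b) / (2 * c) with ht
      have h1 : t < 1 := by rw [ht, div_lt_one hcpos]; linarith
      have h2 : 0 ≤ t := div_nonneg (by linarith) hcpos.le
      have h3 : (0 : S → ℝ) ≤ (1 - t) • regret U M h := smul_nonneg (by linarith) hh0
      -- Dropping the share of f leaves (1 - t) c, the midpoint of b and c, hence above b.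
      refine lt_of_lt_of_le ?_ (hN.mono _ _ h3 (le_add_of_nonneg_left (smul_nonneg h2 hf0)))
      rw [hN.smul _ _ (by linarith) hh0]
      have : t * (2 * c) = c - b := div_mul_cancel₀ _ hcpos.ne'
      nlinarith
  ambiguity_aversion M hM f hf g hg p hp hp1 hi := by
    have hb := hB.utilBounded hM
    have hk : regret U (M ∪ {mix p f g}) g = regret U M g := by
      refine regret_union hb ⟨f, hf⟩ ?_ g
      rintro _ rfl s
      have h1 := le_csSup (hb s) ⟨f, hf, rfl⟩
      have h2 := le_csSup (hb s) ⟨g, hg, rfl⟩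
      rw [util_mix]
      nlinarith [mul_le_mul_of_nonneg_left h1 p.2.1,
        mul_le_mul_of_nonneg_left h2 (sub_nonneg.2 p.2.2)]
    have hf0 := regret_nonneg hb hf
    have hg0 := regret_nonneg hb hg
    rw [hR _ (h𝓜.insert_mem hM _) _ (.inr rfl) _ (.inl hg), regret_mix hb hf hg, hk]
    rw [hR.indiff_iff hM hf hg] at hi
    have hp' := sub_nonneg.2 p.2.2
    refine (hN.add_le _ _ (smul_nonneg p.2.1 hf0) (smul_nonneg hp' hg0)).trans ?_
    rw [hN.smul _ _ p.2.1 hf0, hN.smul _ _ hp' hg0, hi]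
    exact le_of_eq (by ring)
  independence M hM f hf g hg h p hp hp1 := by
    have hb := hB.utilBounded hM
    have hp' : (0 : ℝ) < p := hp
    rw [hR M hM f hf g hg, hR _ (h𝓜.mixture M hM h p hp hp1) _ ⟨f, hf, rfl⟩ _ ⟨g, hg, rfl⟩,
      regret_mixMenu hb ⟨f, hf⟩ h hp, regret_mixMenu hb ⟨f, hf⟩ h hp,
      hN.smul _ _ hp'.le (regret_nonneg hb hf), hN.smul _ _ hp'.le (regret_nonneg hb hg),
      mul_le_mul_iff_right₀ hp']
  menu_independence_const M hM M' hM' l l' h1 h2 h3 h4 := by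
    rw [hR.const_iff hN hM (hB.utilBounded hM) h1 h2,
      hR.const_iff hN hM' (hB.utilBounded hM') h3 h4]
  ina M hM M' hM' h := by
    refine hR.limitINA hN h𝓜 hB M hM M' hM' fun k hk s l hl => ?_
    obtain ⟨f, hf, hfk⟩ := h k hk s
    have := hl f hf
    rw [hR.constPref_iff hN h𝓜] at *
    exact hfk.trans this
  boundedness M hM := by
    obtain ⟨l, hl⟩ := hB M hM
    exact ⟨l, fun f hf s => (hR.constPref_iff hN h𝓜 _ _).2 (hl f hf s)⟩

/-- An event is null iff its upper probability vanishes. -/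
lemma nonNull_iff (hU : ∃ y₁ y₂, U y₁ ≠ U y₂) (hB : MenusBounded 𝓜 U) (E : Set S) :
    NonNull 𝓜 R E ↔ 0 < N (E.indicator 1) := by
  constructor
  · intro h
    by_contra h0
    replace h0 := le_antisymm (not_lt.1 h0) (hN.nonneg (indicator_nonneg_vec E zero_le_one))
    refine h fun f g M hM hf hg => ?_
    have hb := hB.utilBounded hM
    rw [hR.indiff_iff hM hf hg]
    refine hN.eq_of_indicator_compl_eq h0 (regret_nonneg hb hf) (regret_nonneg hb hg) fun s hs => ?_
    simp [regret, splice, hs]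
  · intro h hall
    obtain ⟨l, l', hl⟩ := exists_util_lt hU
    -- A bet on E against its worse prize: the bet has no regret, and the sure act regrets a
    -- positive multiple of the indicator of E.
    have hM := h𝓜.pair_mem (splice (const l') E (const l) : Act S Y) (const l)
    have hi := hall (const l') (const l) _ hM (by simp) (by simp)
    have htop : ∀ g ∈ ({splice (const l') E (const l), const l} : Set (Act S Y)), ∀ s,
        util U (g s) ≤ util U (splice (const l') E (const l) s) := by
      rintro g (rfl | rfl) s
      · exact le_rfl
      · by_cases hs : s ∈ E <;> simp [splice, hs, hl.le]
    rw [hR.indiff_iff hM (by simp) (by simp),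
      funext (regret_eq_of_top (by simp) htop (const l)),
      funext (regret_eq_of_top (by simp) htop (splice (const l') E (const l)))] at hi
    have h1 : (fun s => util U (splice (const l') E (const l) s) - util U ((const l : Act S Y) s)) =
        (util U l' - util U l) • E.indicator 1 := by
      funext s
      by_cases hs : s ∈ E <;> simp [splice, hs]
    have h2 : (fun s => util U ((splice (const l') E (const l) : Act S Y) s) -
        util U ((splice (const l') E (const l) : Act S Y) s)) = 0 := by
      funext s
      simp
    rw [h1, h2, hN.zero, hN.smul _ _ (sub_pos.2 hl).le (indicator_nonneg_vec E zero_le_one)] at hi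
    exact (mul_pos (sub_pos.2 hl) h).ne hi

end MinimizesRegret

/-! ### MWER preferences and their updates as minimizers of upper expected regret -/

variable [Fintype S] {𝓜 : Set (Set (Act S Y))} {U : Y → ℝ} {P : Set ((S → ℝ) × ℝ)}

lemma IsWeightedSet.mwerPref_update_iff (hP : IsWeightedSet P) {E : Set S} (hE : 0 < upperLik P E)
    {M : Set (Act S Y)} (hb : UtilBounded U M) {f g : Act S Y} (hf : f ∈ M) (hg : g ∈ M) :
    mwerPref U (update P E) M f g ↔
      upperExp P (E.indicator (regret U M f)) ≤ upperExp P (E.indicator (regret U M g)) := by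
  rw [mwerPref, weightedRegret_eq, weightedRegret_eq, hP.upperExp_update hE (regret_nonneg hb hf),
    hP.upperExp_update hE (regret_nonneg hb hg), div_le_div_iff_of_pos_right hE]

lemma IsWeightedSet.minimizesRegret_update (hP : IsWeightedSet P) (hB : MenusBounded 𝓜 U)
    {E : Set S} (hE : 0 < upperLik P E) :
    MinimizesRegret 𝓜 (mwerCondPref U P E) U
      fun v => upperExp P (E.indicator v) / upperLik P E := by
  intro M hM f hf g hg
  rw [mwerCondPref, hP.mwerPref_update_iff hE (hB.utilBounded hM) hf hg,
    div_le_div_iff_of_pos_right hE]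

lemma IsWeightedSet.minimizesRegret_univ (hP : IsWeightedSet P) (hB : MenusBounded 𝓜 U) :
    MinimizesRegret 𝓜 (mwerCondPref U P univ) U (upperExp P) := by
  intro M hM f hf g hg
  have hb := hB.utilBounded hM
  rw [mwerCondPref, hP.mwerPref_update_iff (by simp [hP.upperLik_univ]) hb hf hg,
    indicator_univ, indicator_univ]

lemma mdc_mwerCondPref (h𝓜 : IsMenuCollection 𝓜) (hU : ∃ y₁ y₂, U y₁ ≠ U y₂)
    (hP : IsWeightedSet P) (hB : MenusBounded 𝓜 U) : MDC 𝓜 (mwerCondPref U P) := by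
  intro E hE M hM f hf g hg
  have hb := hB.utilBounded hM
  have hR := hP.minimizesRegret_univ hB
  rw [hR.nonNull_iff hP.isUpperExpectation h𝓜 hU hB, ← upperLik_eq] at hE
  -- Both sides compare the upper expectations of the regrets restricted to E, for every h.
  have key : ∀ h ∈ M, (mwerCondPref U P univ (spliceMenu M E h) (splice f E h) (splice g E h) ↔
      mwerCondPref U P E M f g) := by
    intro h hh
    rw [mwerCondPref, mwerCondPref, hP.mwerPref_update_iff hE hb hf hg]
    exact (hR _ (h𝓜.splice M hM E h hh) _ ⟨f, hf, rfl⟩ _ ⟨g, hg, rfl⟩).trans (by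
      rw [regret_spliceMenu ⟨f, hf⟩, regret_spliceMenu ⟨f, hf⟩])
  constructor
  · exact fun h => ⟨f, hf, (key f hf).2 h⟩
  · rintro ⟨h, hh, h'⟩
    exact (key h hh).1 h'

end

section

variable {Y : Type*}

/-! ### The von Neumann–Morgenstern theorem -/

/-- Preferences over lotteries that satisfy the axioms of von Neumann and Morgenstern. -/
structure IsVNM (r : Lottery Y → Lottery Y → Prop) : Prop where
  trans : ∀ l m n, r l m → r m n → r l n
  total : ∀ l m, r l m ∨ r m l
  indep : ∀ l m n (p : unitInterval), 0 < p → p < 1 →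
    (r l m ↔ r (mixLottery p l n) (mixLottery p m n))
  cont : ∀ l m n, ¬ r m l → ¬ r n m → ∃ q : unitInterval, 0 < q ∧ q < 1 ∧ r (mixLottery q l n) m

/-- The total mass of a finitely supported function. -/
def totalMass : (Y →₀ ℝ) →ₗ[ℝ] ℝ := Finsupp.linearCombination ℝ fun _ => (1 : ℝ)

@[simp]
lemma totalMass_weights (l : Lottery Y) : totalMass l.weights = 1 := by
  simp [totalMass, Finsupp.linearCombination_apply]

/-- The lottery with given weights. -/
def lotteryOfWeights (w : Y →₀ ℝ) (h : 0 ≤ w) (h1 : totalMass w = 1) : Lottery Y where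
  weights := w
  nonneg := h
  total := by simpa [totalMass, Finsupp.linearCombination_apply] using h1

/-- Every signed measure of mass zero is a positive multiple of a difference of lotteries. -/
lemma exists_eq_smul_sub_of_totalMass (l₀ : Lottery Y) {d : Y →₀ ℝ} (hd : totalMass d = 0) :
    ∃ c : ℝ, 0 < c ∧ ∃ l l' : Lottery Y, d = c • (l.weights - l'.weights) := by
  -- Write d = a - (a - d) with a the positive part; both terms have the same mass. Adding `l₀`
  -- makes that mass positive, and dividing by c = 1 + mass(a) gives lotteries.
  set a : Y →₀ ℝ := d.mapRange (fun x => max x 0) (by simp) with ha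
  have ha0 : 0 ≤ a := fun y => by simp [ha]
  have had : 0 ≤ a - d := fun y => by simp [ha]
  have hm : 0 ≤ totalMass a := by
    rw [totalMass, Finsupp.linearCombination_apply]
    exact Finsupp.sum_nonneg fun y _ => by simpa using ha0 y
  set c := 1 + totalMass a with hc
  have hc0 : 0 < c := by linarith
  refine ⟨c, hc0,
    lotteryOfWeights (c⁻¹ • (a + l₀.weights)) (smul_nonneg (by positivity)
      (add_nonneg ha0 l₀.nonneg)) ?_,
    lotteryOfWeights (c⁻¹ • (a - d + l₀.weights)) (smul_nonneg (by positivity)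
      (add_nonneg had l₀.nonneg)) ?_, ?_⟩
  · rw [map_smul, map_add, totalMass_weights, smul_eq_mul, add_comm, ← hc, inv_mul_cancel₀ hc0.ne']
  · rw [map_smul, map_add, map_sub, hd, sub_zero, totalMass_weights, smul_eq_mul, add_comm, ← hc,
      inv_mul_cancel₀ hc0.ne']
  · simp only [lotteryOfWeights]
    rw [← smul_sub, smul_inv_smul₀ hc0.ne']
    abel

lemma mixLottery_symm (p : unitInterval) (l l' : Lottery Y) :
    mixLottery (unitInterval.symm p) l l' = mixLottery p l' l := by
  ext1
  rw [weights_mixLottery, weights_mixLottery, unitInterval.coe_symm_eq]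
  module

/-- The midpoint weight. -/
def halfWeight : unitInterval := ⟨1 / 2, by norm_num, by norm_num⟩

@[simp] lemma coe_halfWeight : (halfWeight : ℝ) = 1 / 2 := rfl

lemma halfWeight_pos : 0 < halfWeight := by
  rw [← Subtype.coe_lt_coe]; norm_num

lemma halfWeight_lt_one : halfWeight < 1 := by
  rw [← Subtype.coe_lt_coe]; norm_num

/-- The weight `a / (a + b)`. -/
def shareWeight {a b : ℝ} (ha : 0 < a) (hb : 0 < b) : unitInterval :=
  ⟨a / (a + b), by positivity, by rw [div_le_one (by positivity)]; linarith⟩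

lemma coe_shareWeight {a b : ℝ} (ha : 0 < a) (hb : 0 < b) :
    (shareWeight ha hb : ℝ) = a / (a + b) := rfl

lemma shareWeight_pos {a b : ℝ} (ha : 0 < a) (hb : 0 < b) : 0 < shareWeight ha hb := by
  rw [← Subtype.coe_lt_coe, coe_shareWeight]
  simp only [Icc.coe_zero]
  positivity

lemma shareWeight_lt_one {a b : ℝ} (ha : 0 < a) (hb : 0 < b) : shareWeight ha hb < 1 := by
  rw [← Subtype.coe_lt_coe, coe_shareWeight, Icc.coe_one, div_lt_one (by positivity)]
  linarith

lemma smul_weights_shareWeight {a b : ℝ} (ha : 0 < a) (hb : 0 < b) (l l' : Lottery Y) :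
    (a + b) • (mixLottery (shareWeight ha hb) l l').weights = a • l.weights + b • l'.weights := by
  have h : a + b ≠ 0 := by positivity
  rw [weights_mixLottery, coe_shareWeight, smul_add, smul_smul, smul_smul, mul_sub,
    mul_div_cancel₀ _ h, mul_one, add_sub_cancel_left]

namespace IsVNM

variable {r : Lottery Y → Lottery Y → Prop} (hr : IsVNM r)
include hr

lemma refl (l : Lottery Y) : r l l := (hr.total l l).elim id id

lemma indep_right (l m n : Lottery Y) {p : unitInterval} (hp : 0 < p) (hp1 : p < 1) :
    r l m ↔ r (mixLottery p n l) (mixLottery p n m) := by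
  rw [← mixLottery_symm, ← mixLottery_symm p m n]
  refine hr.indep l m n _ ?_ ?_
  · rw [← Subtype.coe_lt_coe, unitInterval.coe_symm_eq]
    have : (p : ℝ) < 1 := hp1
    simpa using this
  · rw [← Subtype.coe_lt_coe, unitInterval.coe_symm_eq]
    have : (0 : ℝ) < p := hp
    simpa using this

lemma mixLottery_mono {l l' m m' : Lottery Y} {p : unitInterval} (hp : 0 < p) (hp1 : p < 1)
    (h : r l l') (h' : r m m') : r (mixLottery p l m) (mixLottery p l' m') :=
  hr.trans _ _ _ ((hr.indep l l' m p hp hp1).1 h) ((hr.indep_right m m' l' hp hp1).1 h')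

/-- The preference between two lotteries depends only on the direction of their difference. -/
lemma of_smul_sub_eq {c d : ℝ} (hc : 0 < c) (hd : 0 < d) {l l' m m' : Lottery Y}
    (h : c • (l.weights - l'.weights) = d • (m.weights - m'.weights)) (hm : r m m') : r l l' := by
  -- Rearranged, the hypothesis reads c l + d m' = c l' + d m, an equality of mixtures after
  -- division by c + d.
  have hmix : mixLottery (shareWeight hc hd) l m' = mixLottery (shareWeight hc hd) l' m := by
    ext1
    apply smul_right_injective _ (show c + d ≠ 0 by positivity)
    simp only [smul_weights_shareWeight]
    rw [smul_sub, smul_sub, sub_eq_sub_iff_add_eq_add] at h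
    rw [h, add_comm]
  rw [hr.indep l l' m' _ (shareWeight_pos hc hd) (shareWeight_lt_one hc hd), hmix]
  exact (hr.indep_right m m' l' (shareWeight_pos hc hd) (shareWeight_lt_one hc hd)).1 hm

/-- A small multiple of a negative difference does not outweigh a positive one. -/
lemma archimedean {a b c d : Lottery Y} (hab : ¬ r b a) (hcd : ¬ r c d) :
    ∃ q : unitInterval, 0 < q ∧ q < 1 ∧
      r (mixLottery q (mixLottery halfWeight a d) (mixLottery halfWeight b c))
        (mixLottery halfWeight b d) := by
  -- Continuity applies to (a + d)/2 ≻ (b + d)/2 ≻ (b + c)/2. The conclusion says that q (a - b) +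
  -- (1 - q) (c - d) is a nonnegative direction.
  refine hr.cont _ _ _ ?_ ?_
  · rwa [← hr.indep _ _ _ _ halfWeight_pos halfWeight_lt_one]
  · rwa [← hr.indep_right _ _ _ halfWeight_pos halfWeight_lt_one]

/-- The cone of nonnegative differences of lotteries, completed by the multiples of `l₀`. -/
def cone (l₀ : Lottery Y) : PointedCone ℝ (Y →₀ ℝ) where
  -- Only the part of v of mass zero is constrained, so the cone contains the whole line through
  -- `l₀` and covers directions of every mass.
  carrier := {v | ∃ c : ℝ, 0 < c ∧ ∃ l l', r l l' ∧
    v = totalMass v • l₀.weights + c • (l.weights - l'.weights)}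
  add_mem' := by
    rintro v w ⟨c, hc, l, l', hl, hv⟩ ⟨d, hd, m, m', hm, hw⟩
    refine ⟨c + d, by positivity, mixLottery (shareWeight hc hd) l m,
      mixLottery (shareWeight hc hd) l' m',
      hr.mixLottery_mono (shareWeight_pos hc hd) (shareWeight_lt_one hc hd) hl hm, ?_⟩
    rw [smul_sub, smul_weights_shareWeight, smul_weights_shareWeight, map_add]
    nth_rewrite 1 [hv, hw]
    module
  zero_mem' := ⟨1, one_pos, l₀, l₀, hr.refl l₀, by simp⟩
  smul_mem' := by
    rintro ⟨t, ht⟩ v ⟨c, hc, l, l', hl, hv⟩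
    rcases ht.eq_or_lt with rfl | ht
    · exact ⟨1, one_pos, l₀, l₀, hr.refl l₀, by simp⟩
    · refine ⟨t * c, by positivity, l, l', hl, ?_⟩
      simp only [Nonneg.mk_smul, map_smul]
      nth_rewrite 1 [hv]
      simp only [smul_eq_mul]
      module

lemma mem_cone_iff {l₀ : Lottery Y} {v : Y →₀ ℝ} : v ∈ hr.cone l₀ ↔ ∃ c : ℝ, 0 < c ∧ ∃ l l',
    r l l' ∧ v = totalMass v • l₀.weights + c • (l.weights - l'.weights) := Iff.rfl

lemma sub_mem_cone_iff {l₀ l l' : Lottery Y} : l.weights - l'.weights ∈ hr.cone l₀ ↔ r l l' := by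
  rw [mem_cone_iff]
  constructor
  · rintro ⟨c, hc, m, m', hm, h⟩
    refine hr.of_smul_sub_eq one_pos hc ?_ hm
    rw [one_smul, h]
    simp
  · exact fun h => ⟨1, one_pos, l, l', h, by simp⟩

/-- **The von Neumann–Morgenstern theorem**. -/
theorem exists_util {l₁ l₀ : Lottery Y} (h : ¬ r l₀ l₁) :
    ∃ U : Y → ℝ, ∀ l l', r l l' ↔ util U l' ≤ util U l := by
  set e := l₁.weights - l₀.weights with he
  have he0 : e ≠ 0 := by
    intro h0
    rw [he, sub_eq_zero, Convexity.StdSimplex.weights_inj] at h0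
    exact h (h0 ▸ hr.refl _)
  have hne : -e ∉ hr.cone l₀ := by
    rw [he, neg_sub, hr.sub_mem_cone_iff]
    exact h
  -- Extend t e ↦ t from the line through e to a functional nonnegative on the cone. It is
  -- nonnegative on that part of the cone because -e is not in it; the second condition requires
  -- every y to enter the cone after adding a multiple of e.
  obtain ⟨g, hge, hg⟩ := riesz_extension (hr.cone l₀) (LinearPMap.mkSpanSingleton e (1 : ℝ) he0)
    (by
      rintro ⟨x, hx⟩ hxK
      obtain ⟨t, rfl⟩ := Submodule.mem_span_singleton.1 hx
      refine le_of_le_of_eq ?_ (LinearPMap.mkSpanSingleton'_apply (σ := RingHom.id ℝ) e (1 : ℝ)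
        _ t hx).symm
      rw [RingHom.id_apply, smul_eq_mul, mul_one]
      by_contra! ht
      refine hne ?_
      have := (hr.cone l₀).smul_mem (inv_nonneg.2 (neg_nonneg.2 ht.le)) hxK
      simpa [smul_smul, inv_neg, ht.ne] using this)
    (by
      intro y
      have hy : totalMass (y - totalMass y • l₀.weights) = 0 := by simp
      obtain ⟨c, hc, l, l', hd⟩ := exists_eq_smul_sub_of_totalMass l₀ hy
      have hte : totalMass e = 0 := by simp [he]
      by_cases hl : r l l'
      · refine ⟨⟨0, Submodule.zero_mem _⟩, ?_⟩
        rw [zero_add, mem_cone_iff]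
        exact ⟨c, hc, l, l', hl, by rw [← hd]; abel⟩
      · obtain ⟨q, hq, hq1, hq'⟩ := hr.archimedean h hl
        have hq0 : (0 : ℝ) < q := hq
        have hq1' : (q : ℝ) < 1 := hq1
        have h1q : (0 : ℝ) < 1 - q := by linarith
        -- `archimedean` makes q e + (1 - q) (l - l') nonnegative; scaling by c / (1 - q) leaves c
        -- (l - l') plus this multiple of e. The factor 2 below undoes the midpoints.
        refine ⟨⟨(q * c / (1 - q)) • e, Submodule.smul_mem _ _
          (Submodule.mem_span_singleton_self e)⟩, ?_⟩
        rw [mem_cone_iff]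
        refine ⟨2 * c / (1 - q), by positivity, _, _, hq', ?_⟩
        simp only [map_add, map_smul, hte, smul_zero, zero_add, weights_mixLottery,
          coe_halfWeight]
        have hd' : y = totalMass y • l₀.weights + c • (l.weights - l'.weights) := by
          rw [← hd]; abel
        nth_rewrite 1 [hd']
        rw [he]
        match_scalars <;> field_simp <;> ring)
  have hge1 : g e = 1 := by
    have := hge ⟨e, Submodule.mem_span_singleton_self e⟩
    rw [this, LinearPMap.mkSpanSingleton_apply]
  have hutil : ∀ l, util (fun y => g (Finsupp.single y 1)) l = g l.weights := by
    intro l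
    rw [util_eq_linearCombination]
    have : Finsupp.linearCombination ℝ (fun y => g (Finsupp.single y 1)) = g := by
      ext y
      simp
    rw [this]
  have hmono : ∀ l l', r l l' → g l'.weights ≤ g l.weights := by
    intro l l' hl
    have := hg _ ((hr.sub_mem_cone_iff (l₀ := l₀)).2 hl)
    rwa [map_sub, sub_nonneg] at this
  refine ⟨fun y => g (Finsupp.single y 1), fun l l' => ?_⟩
  rw [hutil, hutil]
  refine ⟨hmono l l', fun hle => ?_⟩
  by_contra hl
  -- Applying g to the nonnegative direction q (l' - l) - (1 - q) e would force g(l') > g(l).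
  obtain ⟨q, hq, hq1, hq'⟩ := hr.archimedean hl h
  have hq0 : (0 : ℝ) < q := hq
  have hq1' : (q : ℝ) < 1 := hq1
  have := hmono _ _ hq'
  simp only [weights_mixLottery, map_add, map_smul, smul_eq_mul, coe_halfWeight] at this
  rw [he, map_sub] at hge1
  nlinarith

end IsVNM

/-- Utilities that represent the same preferences over lotteries are affinely related. -/
lemma exists_affine_of_util_le_iff {U V : Y → ℝ} {l₀ l₁ : Lottery Y} (h : util U l₀ < util U l₁)
    (hUV : ∀ l l', util U l' ≤ util U l ↔ util V l' ≤ util V l) :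
    ∃ a b : ℝ, 0 < a ∧ V = fun y => a * U y + b := by
  have hV : util V l₀ < util V l₁ := by
    rw [lt_iff_not_ge, ← hUV, not_le]
    exact h
  have key : ∀ d : Y →₀ ℝ, totalMass d = 0 → Finsupp.linearCombination ℝ U d = 0 →
      Finsupp.linearCombination ℝ V d = 0 := by
    intro d hd hU
    obtain ⟨c, hc, l, l', rfl⟩ := exists_eq_smul_sub_of_totalMass l₀ hd
    rw [map_smul, map_sub, ← util_eq_linearCombination, ← util_eq_linearCombination, smul_eq_mul,
      mul_eq_zero, or_iff_right hc.ne', sub_eq_zero] at hU ⊢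
    exact le_antisymm ((hUV _ _).1 hU.le) ((hUV _ _).1 hU.ge)
  set δ := util U l₁ - util U l₀ with hδ
  have hδ0 : 0 < δ := sub_pos.2 h
  refine ⟨(util V l₁ - util V l₀) / δ,
    util V l₀ - (util V l₁ - util V l₀) / δ * util U l₀, div_pos (sub_pos.2 hV) hδ0, ?_⟩
  funext y
  -- This combination has mass zero and U-integral zero; the vanishing of its V-integral is the
  -- affine relation at y.
  have := key (δ • (Finsupp.single y 1 - l₀.weights) -
    (U y - util U l₀) • (l₁.weights - l₀.weights)) (by simp [totalMass_weights]; simp [totalMass])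
    (by
      simp only [map_sub, map_smul, ← util_eq_linearCombination, smul_eq_mul,
        Finsupp.linearCombination_single, one_mul, hδ]
      ring)
  simp only [map_sub, map_smul, ← util_eq_linearCombination, smul_eq_mul,
        Finsupp.linearCombination_single, one_mul] at this
  field_simp
  linarith

end

section

variable {S Y : Type*}

/-! ### Preferences over constant acts -/

namespace Axioms

variable {𝓜 : Set (Set (Act S Y))} {R : MenuPref S Y} (hA : Axioms 𝓜 R)
  (h𝓜 : IsMenuCollection 𝓜)
include hA h𝓜

lemma menu_const_iff {M : Set (Act S Y)} (hM : M ∈ 𝓜) {l l' : Lottery Y} (h : const l ∈ M)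
    (h' : const l' ∈ M) : R M (const l) (const l') ↔ ConstPref R l l' :=
  hA.menu_independence_const M hM _ (h𝓜.pair_mem _ _) l l' h h' (by simp) (by simp)

omit hA in
lemma _root_.MWER.IsMenuCollection.triple_mem (f g h : Act S Y) : {f, g, h} ∈ 𝓜 :=
  h𝓜.finite _ (toFinite _) ⟨f, by simp⟩

lemma isVNM : IsVNM (ConstPref R) where
  trans l m n h h' := by
    have hM := h𝓜.triple_mem (const l : Act S Y) (const m) (const n)
    rw [← hA.menu_const_iff h𝓜 hM (by simp) (by simp)] at *
    exact hA.transitivity _ hM _ (by simp) _ (by simp) _ (by simp) h h'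
  total l m := by
    have hM := h𝓜.pair_mem (const l : Act S Y) (const m)
    rw [← hA.menu_const_iff h𝓜 hM (by simp) (by simp),
      ← hA.menu_const_iff h𝓜 hM (by simp) (by simp)]
    exact hA.completeness _ hM _ (by simp) _ (by simp)
  indep l m n p hp hp1 := by
    have hM := h𝓜.pair_mem (const l : Act S Y) (const m)
    rw [← hA.menu_const_iff h𝓜 hM (by simp) (by simp),
      hA.independence _ hM _ (by simp) _ (by simp) (const n) p hp hp1, mix_const, mix_const]
    exact hA.menu_const_iff h𝓜 (h𝓜.mixture _ hM (const n) p hp hp1)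
      ⟨const l, by simp, mix_const ..⟩ ⟨const m, by simp, mix_const ..⟩
  cont l m n h h' := by
    have hM := h𝓜.triple_mem (const l : Act S Y) (const m) (const n)
    have hlm : Strict R {const l, const m, const n} (const l) (const m) := by
      have : ¬ R {const l, const m, const n} (const m) (const l) := by
        rwa [hA.menu_const_iff h𝓜 hM (by simp) (by simp)]
      exact ⟨(hA.completeness _ hM _ (by simp) _ (by simp)).resolve_right this, this⟩
    have hmn : Strict R {const l, const m, const n} (const m) (const n) := by
      have : ¬ R {const l, const m, const n} (const n) (const m) := by
        rwa [hA.menu_const_iff h𝓜 hM (by simp) (by simp)]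
      exact ⟨(hA.completeness _ hM _ (by simp) _ (by simp)).resolve_right this, this⟩
    obtain ⟨q, -, ⟨hq, hq1⟩, -, hqm, -⟩ := hA.mixture_continuity _ hM _ (by simp) _ (by simp) _
      (by simp) hlm hmn
    refine ⟨q, hq, hq1, ?_⟩
    have hM' := h𝓜.insert_mem hM (mix q (const l) (const n))
    rw [mix_const] at hqm hM'
    rw [← hA.menu_const_iff h𝓜 hM' (.inr rfl) (.inl (by simp))]
    exact hqm.1

omit h𝓜 in
-- If all lotteries were indifferent, monotonicity would make all acts indifferent.
lemma exists_not_constPref : ∃ l l' : Lottery Y, ¬ ConstPref R l l' := by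
  by_contra! h
  obtain ⟨M, hM, f, hf, g, hg, -, hn⟩ := hA.nontriviality
  exact hn (hA.monotonicity M hM g hg f hf fun s => h _ _)

end Axioms

/-! ### The order on regret vectors -/

/-- The family `R` satisfies the axioms, and its preferences over constant acts are represented by
the expected utility for `U`, which is not constant. -/
structure AxiomsWithUtil (𝓜 : Set (Set (Act S Y))) (R : MenuPref S Y) (U : Y → ℝ) : Prop where
  menus : IsMenuCollection 𝓜
  ax : Axioms 𝓜 R
  constPref_iff : ∀ l l', ConstPref R l l' ↔ util U l' ≤ util U l
  exists_lt : ∃ l l', util U l < util U l'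

/-- `f ⪰ g` for acts whose regret vectors, up to a common factor, are `v` and `w`. -/
def RegretPref (R : MenuPref S Y) (U : Y → ℝ) (v w : S → ℝ) : Prop :=
  -- The factor c is needed because the range of utilities may be too short to realize v and w
  -- themselves. The act k attains the best utilities.
  ∃ (k f g : Act S Y) (c : ℝ), 0 < c ∧
    (∀ s, util U (f s) ≤ util U (k s)) ∧ (∀ s, util U (g s) ≤ util U (k s)) ∧
    (∀ s, util U (k s) - util U (f s) = c * v s) ∧
    (∀ s, util U (k s) - util U (g s) = c * w s) ∧ R {k, f, g} f g

/-- The scale is c = (u(l₁) - u(l₀)) / (K + 1), so regrets up to K fit between two lotteries of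
different utility; K + 1 avoids division by zero. -/
lemma exists_scaled_acts {U : Y → ℝ} (hU : ∃ l l', util U l < util U l') {K : ℝ} (hK : 0 ≤ K) :
    ∃ c : ℝ, 0 < c ∧ ∃ l : Lottery Y,
      (∀ v : S → ℝ, 0 ≤ v → (∀ s, v s ≤ K) →
        ∃ f : Act S Y, ∀ s, util U l - util U (f s) = c * v s) ∧
      ∀ t : ℝ, 0 ≤ t → t ≤ K → ∃ m : Lottery Y, util U l - util U m = c * t := by
  obtain ⟨l₀, l₁, h⟩ := hU
  have hd : 0 < util U l₁ - util U l₀ := sub_pos.2 h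
  have key : ∀ t : ℝ, 0 ≤ t → t ≤ K → ∃ m : Lottery Y,
      util U l₁ - util U m = (util U l₁ - util U l₀) / (K + 1) * t := by
    intro t ht htK
    have h1 : 0 ≤ (util U l₁ - util U l₀) / (K + 1) * t := by positivity
    have h2 : (util U l₁ - util U l₀) / (K + 1) * t ≤ util U l₁ - util U l₀ := by
      rw [div_mul_eq_mul_div, div_le_iff₀ (by positivity)]
      nlinarith
    obtain ⟨m, hm⟩ := exists_util_eq (U := U) (l := l₀) (l' := l₁)
      (t := util U l₁ - (util U l₁ - util U l₀) / (K + 1) * t) (by linarith) (by linarith)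
    exact ⟨m, by rw [hm]; ring⟩
  refine ⟨(util U l₁ - util U l₀) / (K + 1), by positivity, l₁, fun v hv hvK => ?_, key⟩
  choose f hf using fun s => key (v s) (hv s) (hvK s)
  exact ⟨f, hf⟩

lemma exists_bound [Finite S] (v w z : S → ℝ) :
    ∃ K : ℝ, 0 ≤ K ∧ (∀ s, v s ≤ K) ∧ (∀ s, w s ≤ K) ∧ ∀ s, z s ≤ K := by
  obtain ⟨a, ha⟩ := (finite_range v).bddAbove
  obtain ⟨b, hb⟩ := (finite_range w).bddAbove
  obtain ⟨c, hc⟩ := (finite_range z).bddAbove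
  refine ⟨max 0 (max a (max b c)), le_max_left _ _, fun s => ?_, fun s => ?_, fun s => ?_⟩
  · exact (ha ⟨s, rfl⟩).trans (by simp)
  · exact (hb ⟨s, rfl⟩).trans (by simp)
  · exact (hc ⟨s, rfl⟩).trans (by simp)

namespace AxiomsWithUtil

variable {𝓜 : Set (Set (Act S Y))} {R : MenuPref S Y} {U : Y → ℝ} (hA : AxiomsWithUtil 𝓜 R U)
include hA

lemma of_util_le {M : Set (Act S Y)} (hM : M ∈ 𝓜) {f g : Act S Y} (hf : f ∈ M) (hg : g ∈ M)
    (h : ∀ s, util U (g s) ≤ util U (f s)) : R M f g :=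
  hA.ax.monotonicity M hM f hf g hg fun s => (hA.constPref_iff _ _).2 (h s)

lemma congr_util {M : Set (Act S Y)} (hM : M ∈ 𝓜) {f g f' g' : Act S Y} (hf : f ∈ M) (hg : g ∈ M)
    (hf' : f' ∈ M) (hg' : g' ∈ M) (hff : ∀ s, util U (f s) = util U (f' s))
    (hgg : ∀ s, util U (g s) = util U (g' s)) : R M f g ↔ R M f' g' := by
  constructor <;> intro h
  · exact hA.ax.transitivity M hM _ hf' _ hf _ hg' (hA.of_util_le hM hf' hf fun s => (hff s).le)
      (hA.ax.transitivity M hM _ hf _ hg _ hg' h (hA.of_util_le hM hg hg' fun s => (hgg s).ge))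
  · exact hA.ax.transitivity M hM _ hf _ hf' _ hg (hA.of_util_le hM hf hf' fun s => (hff s).ge)
      (hA.ax.transitivity M hM _ hf' _ hg' _ hg h (hA.of_util_le hM hg' hg fun s => (hgg s).le))

/-- Menus that dominate each other induce the same preferences between acts of the same
utility. -/
lemma congr_menu {M M' : Set (Act S Y)} (hM : M ∈ 𝓜) (hM' : M' ∈ 𝓜) {f g f' g' : Act S Y}
    (hf : f ∈ M) (hg : g ∈ M) (hf' : f' ∈ M') (hg' : g' ∈ M')
    (hff : ∀ s, util U (f s) = util U (f' s)) (hgg : ∀ s, util U (g s) = util U (g' s))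
    (hMM : ∀ h ∈ M', ∀ s, ∃ k ∈ M, util U (h s) ≤ util U (k s))
    (hMM' : ∀ h ∈ M, ∀ s, ∃ k ∈ M', util U (h s) ≤ util U (k s)) :
    R M f g ↔ R M' f' g' := by
  rw [hA.ax.ina M hM M' hM' (fun h hh s => by
      simpa only [hA.constPref_iff] using hMM h hh s) f hf g hg,
    hA.ax.ina M' hM' M hM (fun h hh s => by
      simpa only [hA.constPref_iff] using hMM' h hh s) f' hf' g' hg', union_comm M' M]
  exact hA.congr_util (hA.menus.union M hM M' hM') (.inl hf) (.inl hg) (.inr hf') (.inr hg')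
    hff hgg

/-- Preferences in menus with a best act depend only on the direction of the regret vectors. -/
lemma congr_regret {M M' : Set (Act S Y)} (hM : M ∈ 𝓜) (hM' : M' ∈ 𝓜) {k f g k' f' g' : Act S Y}
    (hk : k ∈ M) (hf : f ∈ M) (hg : g ∈ M) (hk' : k' ∈ M') (hf' : f' ∈ M') (hg' : g' ∈ M')
    (htop : ∀ h ∈ M, ∀ s, util U (h s) ≤ util U (k s))
    (htop' : ∀ h ∈ M', ∀ s, util U (h s) ≤ util U (k' s)) {c : ℝ} (hc : 0 < c)
    (hff : ∀ s, util U (k s) - util U (f s) = c * (util U (k' s) - util U (f' s)))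
    (hgg : ∀ s, util U (k s) - util U (g s) = c * (util U (k' s) - util U (g' s))) :
    R M f g ↔ R M' f' g' := by
  -- With p = 1/(1 + c) and q = c/(1 + c) = p c = 1 - p, mixing M with k' and M' with k gives both
  -- menus the best utilities p u(k) + q u(k'). The regrets then agree, and so do the utilities.
  set p := shareWeight one_pos hc with hp
  set q := shareWeight hc one_pos with hq
  have hpv : (p : ℝ) = 1 / (1 + c) := rfl
  have hqv : (q : ℝ) = c / (c + 1) := rfl
  have hp0 : (0 : ℝ) ≤ p := p.2.1
  have hq0 : (0 : ℝ) ≤ q := q.2.1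
  have hp1 : 1 - (p : ℝ) = q := by rw [hpv, hqv]; field_simp; ring
  have hq1 : 1 - (q : ℝ) = p := by rw [hpv, hqv]; field_simp; ring
  have hpc : (q : ℝ) = p * c := by rw [hpv, hqv]; field_simp; ring
  rw [hA.ax.independence M hM f hf g hg k' p (shareWeight_pos _ _) (shareWeight_lt_one _ _),
    hA.ax.independence M' hM' f' hf' g' hg' k q (shareWeight_pos _ _) (shareWeight_lt_one _ _)]
  refine hA.congr_menu
    (hA.menus.mixture M hM k' p (shareWeight_pos _ _) (shareWeight_lt_one _ _))
    (hA.menus.mixture M' hM' k q (shareWeight_pos _ _) (shareWeight_lt_one _ _))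
    ⟨f, hf, rfl⟩ ⟨g, hg, rfl⟩ ⟨f', hf', rfl⟩ ⟨g', hg', rfl⟩ (fun s => ?_) (fun s => ?_) ?_ ?_
  · rw [util_mix, util_mix, hp1, hq1]
    linear_combination -(p : ℝ) * hff s + (util U (k' s) - util U (f' s)) * hpc
  · rw [util_mix, util_mix, hp1, hq1]
    linear_combination -(p : ℝ) * hgg s + (util U (k' s) - util U (g' s)) * hpc
  · rintro _ ⟨h, hh, rfl⟩ s
    refine ⟨mix p k k', ⟨k, hk, rfl⟩, ?_⟩
    rw [util_mix, util_mix, hp1, hq1]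
    nlinarith [mul_le_mul_of_nonneg_left (htop' h hh s) hq0]
  · rintro _ ⟨h, hh, rfl⟩ s
    refine ⟨mix q k' k, ⟨k', hk', rfl⟩, ?_⟩
    rw [util_mix, util_mix, hp1, hq1]
    nlinarith [mul_le_mul_of_nonneg_left (htop h hh s) hp0]

/-- `RegretPref` is well defined: any realization in a menu with a best act decides it. -/
lemma regretPref_iff {M : Set (Act S Y)} (hM : M ∈ 𝓜) {k f g : Act S Y} (hk : k ∈ M) (hf : f ∈ M)
    (hg : g ∈ M) (htop : ∀ h ∈ M, ∀ s, util U (h s) ≤ util U (k s)) {c : ℝ} (hc : 0 < c)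
    {v w : S → ℝ} (hv : ∀ s, util U (k s) - util U (f s) = c * v s)
    (hw : ∀ s, util U (k s) - util U (g s) = c * w s) : RegretPref R U v w ↔ R M f g := by
  have key : ∀ (k' f' g' : Act S Y) (d : ℝ), 0 < d →
      (∀ s, util U (f' s) ≤ util U (k' s)) → (∀ s, util U (g' s) ≤ util U (k' s)) →
      (∀ s, util U (k' s) - util U (f' s) = d * v s) →
      (∀ s, util U (k' s) - util U (g' s) = d * w s) → (R {k', f', g'} f' g' ↔ R M f g) := by
    intro k' f' g' d hd hf' hg' hv' hw'
    refine hA.congr_regret (k := k') (hA.menus.triple_mem k' f' g') hM (by simp) (by simp)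
      (by simp) hk hf hg
      ?_ htop (c := d / c) (by positivity) (fun s => ?_) (fun s => ?_)
    · rintro h (rfl | rfl | rfl) s
      · exact le_rfl
      · exact hf' s
      · exact hg' s
    · rw [hv', hv]; field_simp
    · rw [hw', hw]; field_simp
  constructor
  · rintro ⟨k', f', g', d, hd, hf', hg', hv', hw', h⟩
    exact (key k' f' g' d hd hf' hg' hv' hw').1 h
  · exact fun h => ⟨k, f, g, c, hc, htop f hf, htop g hg, hv, hw,
      (key k f g c hc (htop f hf) (htop g hg) hv hw).2 h⟩

end AxiomsWithUtil

/-- Preorders on the nonnegative vectors that come from maxmin-type preferences over regrets. -/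
structure IsRegretOrder (Q : (S → ℝ) → (S → ℝ) → Prop) : Prop where
  trans : ∀ v w z, 0 ≤ v → 0 ≤ w → 0 ≤ z → Q v w → Q w z → Q v z
  total : ∀ v w, 0 ≤ v → 0 ≤ w → Q v w ∨ Q w v
  mono : ∀ v w, 0 ≤ v → v ≤ w → Q v w
  smul : ∀ (c : ℝ) v w, 0 < c → 0 ≤ v → 0 ≤ w → Q v w → Q (c • v) (c • w)
  const : ∀ a b : ℝ, 0 ≤ a → a < b → ¬ Q (b • 1) (a • 1)
  cont : ∀ v w z, 0 ≤ v → 0 ≤ w → 0 ≤ z → ¬ Q w v → ¬ Q z w →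
    ∃ q r : ℝ, (0 < q ∧ q < 1) ∧ (0 < r ∧ r < 1) ∧
      ¬ Q w (q • v + (1 - q) • z) ∧ ¬ Q (r • v + (1 - r) • z) w
  convex : ∀ (p : ℝ) v w, 0 < p → p < 1 → 0 ≤ v → 0 ≤ w → Q v w → Q w v →
    Q (p • v + (1 - p) • w) w

/-- The vectors are realized in one finite menu with a best act. Mixtures of its acts stay below
that act, so the enlarged menus of the continuity and ambiguity axioms keep the same regrets. -/
lemma AxiomsWithUtil.isRegretOrder [Finite S] {𝓜 : Set (Set (Act S Y))} {R : MenuPref S Y}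
    {U : Y → ℝ} (hA : AxiomsWithUtil 𝓜 R U) : IsRegretOrder (RegretPref R U) := by
  -- acts with given regret vectors in a common menu with a best act
  have real : ∀ v w z : S → ℝ, 0 ≤ v → 0 ≤ w → 0 ≤ z → ∃ (c : ℝ) (k f g h : Act S Y), 0 < c ∧
      (∀ s, util U (k s) - util U (f s) = c * v s) ∧
      (∀ s, util U (k s) - util U (g s) = c * w s) ∧
      (∀ s, util U (k s) - util U (h s) = c * z s) ∧
      ∀ e ∈ ({k, f, g, h} : Set (Act S Y)), ∀ s, util U (e s) ≤ util U (k s) := by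
    intro v w z hv hw hz
    obtain ⟨K, hK, hvK, hwK, hzK⟩ := exists_bound v w z
    obtain ⟨c, hc, l, hl, -⟩ := exists_scaled_acts (S := S) hA.exists_lt hK
    obtain ⟨f, hf⟩ := hl v hv hvK
    obtain ⟨g, hg⟩ := hl w hw hwK
    obtain ⟨h, hh⟩ := hl z hz hzK
    refine ⟨c, const l, f, g, h, hc, hf, hg, hh, ?_⟩
    rintro e (rfl | rfl | rfl | rfl) s
    · exact le_rfl
    · have := hf s; have := mul_nonneg hc.le (hv s); simp only [const_apply]; linarith
    · have := hg s; have := mul_nonneg hc.le (hw s); simp only [const_apply]; linarith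
    · have := hh s; have := mul_nonneg hc.le (hz s); simp only [const_apply]; linarith
  have hmem : ∀ k f g h : Act S Y, {k, f, g, h} ∈ 𝓜 := fun k f g h =>
    hA.menus.finite _ (toFinite _) ⟨k, by simp⟩
  have strict : ∀ {M : Set (Act S Y)}, M ∈ 𝓜 → ∀ {f g}, f ∈ M → g ∈ M → ¬ R M g f →
      Strict R M f g := fun hM _ _ hf hg h =>
    ⟨(hA.ax.completeness _ hM _ hf _ hg).resolve_right h, h⟩
  have mixtop : ∀ {M : Set (Act S Y)} {k f g : Act S Y},
      (∀ e ∈ M, ∀ s, util U (e s) ≤ util U (k s)) → f ∈ M → g ∈ M → ∀ (q : unitInterval),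
      ∀ e ∈ M ∪ {mix q f g}, ∀ s, util U (e s) ≤ util U (k s) := by
    rintro M k f g htop hf hg q e (he | rfl) s
    · exact htop e he s
    · rw [util_mix]
      nlinarith [mul_le_mul_of_nonneg_left (htop f hf s) q.2.1,
        mul_le_mul_of_nonneg_left (htop g hg s) (sub_nonneg.2 q.2.2)]
  have mixreg : ∀ {k f g : Act S Y} {c : ℝ} {v w : S → ℝ} (q : unitInterval),
      (∀ s, util U (k s) - util U (f s) = c * v s) →
      (∀ s, util U (k s) - util U (g s) = c * w s) →
      ∀ s, util U (k s) - util U (mix q f g s) = c * ((q : ℝ) • v + (1 - q : ℝ) • w) s := by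
    intro k f g c v w q hv hw s
    simp only [util_mix, Pi.add_apply, Pi.smul_apply, smul_eq_mul]
    linear_combination (q : ℝ) * hv s + (1 - q : ℝ) * hw s
  constructor
  · intro v w z hv hw hz h1 h2
    obtain ⟨c, k, f, g, h, hc, hf, hg, hh, htop⟩ := real v w z hv hw hz
    have hM := hmem k f g h
    rw [hA.regretPref_iff hM (by simp) (f := f) (g := g) (by simp) (by simp) htop hc hf hg] at h1
    rw [hA.regretPref_iff hM (by simp) (f := g) (g := h) (by simp) (by simp) htop hc hg hh] at h2
    rw [hA.regretPref_iff hM (by simp) (f := f) (g := h) (by simp) (by simp) htop hc hf hh]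
    exact hA.ax.transitivity _ hM _ (by simp) _ (by simp) _ (by simp) h1 h2
  · intro v w hv hw
    obtain ⟨c, k, f, g, h, hc, hf, hg, hh, htop⟩ := real v w 0 hv hw le_rfl
    have hM := hmem k f g h
    rw [hA.regretPref_iff hM (by simp) (f := f) (g := g) (by simp) (by simp) htop hc hf hg,
      hA.regretPref_iff hM (by simp) (f := g) (g := f) (by simp) (by simp) htop hc hg hf]
    exact hA.ax.completeness _ hM _ (by simp) _ (by simp)
  · intro v w hv hvw
    obtain ⟨c, k, f, g, h, hc, hf, hg, hh, htop⟩ := real v w 0 hv (hv.trans hvw) le_rfl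
    have hM := hmem k f g h
    rw [hA.regretPref_iff hM (by simp) (f := f) (g := g) (by simp) (by simp) htop hc hf hg]
    refine hA.of_util_le hM (by simp) (by simp) fun s => ?_
    have := mul_le_mul_of_nonneg_left (hvw s) hc.le
    linarith [hf s, hg s]
  -- Acts that realize a v with factor c realize v with factor c a.
  · intro a v w ha hv hw h1
    obtain ⟨c, k, f, g, h, hc, hf, hg, hh, htop⟩ := real (a • v) (a • w) 0
      (smul_nonneg ha.le hv) (smul_nonneg ha.le hw) le_rfl
    have hM := hmem k f g h
    rw [hA.regretPref_iff hM (by simp) (f := f) (g := g) (by simp) (by simp) htop hc hf hg]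
    rwa [hA.regretPref_iff hM (by simp) (f := f) (g := g) (by simp) (by simp) htop
      (c := c * a) (by positivity) (fun s => by rw [hf]; simp [mul_assoc])
      (fun s => by rw [hg]; simp [mul_assoc])] at h1
  · intro a b ha hab
    obtain ⟨c, hc, l, -, hl⟩ := exists_scaled_acts (S := S) hA.exists_lt (ha.trans hab.le)
    obtain ⟨m, hm⟩ := hl a ha hab.le
    obtain ⟨n, hn⟩ := hl b (ha.trans hab.le) le_rfl
    have hM := hA.menus.triple_mem (const l : Act S Y) (const m) (const n)
    have hcb : c * a < c * b := mul_lt_mul_of_pos_left hab hc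
    rw [hA.regretPref_iff hM (k := const l) (by simp) (f := const n) (g := const m) (by simp)
      (by simp) ?_ hc (by simpa using fun _ => hn) (by simpa using fun _ => hm),
      hA.ax.menu_const_iff hA.menus hM (by simp) (by simp), hA.constPref_iff]
    · linarith
    · have := mul_nonneg hc.le ha
      rintro e (rfl | rfl | rfl) s <;> simp only [const_apply] <;> linarith
  · intro v w z hv hw hz h1 h2
    obtain ⟨c, k, f, g, h, hc, hf, hg, hh, htop⟩ := real v w z hv hw hz
    have hM := hmem k f g h
    have hkM : k ∈ ({k, f, g, h} : Set (Act S Y)) := by simp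
    have hfM : f ∈ ({k, f, g, h} : Set (Act S Y)) := by simp
    have hgM : g ∈ ({k, f, g, h} : Set (Act S Y)) := by simp
    have hhM : h ∈ ({k, f, g, h} : Set (Act S Y)) := by simp
    rw [hA.regretPref_iff hM hkM hgM hfM htop hc hg hf] at h1
    rw [hA.regretPref_iff hM hkM hhM hgM htop hc hh hg] at h2
    obtain ⟨q, r, ⟨hq, hq1⟩, ⟨hr, hr1⟩, hqm, hrm⟩ := hA.ax.mixture_continuity _ hM f hfM g hgM
      h hhM (strict hM hfM hgM h1) (strict hM hgM hhM h2)
    refine ⟨q, r, ⟨hq, hq1⟩, ⟨hr, hr1⟩, ?_, ?_⟩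
    · rw [hA.regretPref_iff (hA.menus.insert_mem hM (mix q f h)) (.inl hkM) (.inl hgM) (.inr rfl)
        (mixtop htop hfM hhM q) hc hg (mixreg q hf hh)]
      exact hqm.2
    · rw [hA.regretPref_iff (hA.menus.insert_mem hM (mix r f h)) (.inl hkM) (.inr rfl) (.inl hgM)
        (mixtop htop hfM hhM r) hc (mixreg r hf hh) hg]
      exact hrm.2
  · intro p v w hp hp1 hv hw h1 h2
    obtain ⟨c, k, f, g, h, hc, hf, hg, hh, htop⟩ := real v w 0 hv hw le_rfl
    have hM := hmem k f g h
    have hkM : k ∈ ({k, f, g, h} : Set (Act S Y)) := by simp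
    have hfM : f ∈ ({k, f, g, h} : Set (Act S Y)) := by simp
    have hgM : g ∈ ({k, f, g, h} : Set (Act S Y)) := by simp
    rw [hA.regretPref_iff hM hkM hfM hgM htop hc hf hg] at h1
    rw [hA.regretPref_iff hM hkM hgM hfM htop hc hg hf] at h2
    have := hA.ax.ambiguity_aversion _ hM f hfM g hgM ⟨p, hp.le, hp1.le⟩ hp hp1 ⟨h1, h2⟩
    rwa [← hA.regretPref_iff (hA.menus.insert_mem hM _) (.inl hkM) (.inr rfl) (.inl hgM)
        (mixtop htop hfM hgM _) hc (mixreg _ hf hg) hg] at this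

end

section

variable {S : Type*}

/-! ### The numerical representation of regret orders -/

namespace IsRegretOrder

variable {Q : (S → ℝ) → (S → ℝ) → Prop} (hQ : IsRegretOrder Q)
include hQ

lemma const_iff {a b : ℝ} (ha : 0 ≤ a) (hb : 0 ≤ b) : Q (a • 1) (b • 1) ↔ a ≤ b := by
  constructor
  · intro h
    by_contra! hlt
    exact hQ.const b a hb hlt h
  · intro h
    refine hQ.mono _ _ (smul_nonneg ha zero_le_one) fun s => ?_
    simpa using h

/-- Every vector is equivalent to a constant one. -/
lemma exists_const_equiv [Finite S] {v : S → ℝ} (hv : 0 ≤ v) :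
    ∃ t : ℝ, 0 ≤ t ∧ Q v (t • 1) ∧ Q (t • 1) v := by
  obtain ⟨K, hK, hvK, -, -⟩ := exists_bound v v v
  have hc : ∀ {t : ℝ}, 0 ≤ t → (0 : S → ℝ) ≤ t • 1 := fun ht => smul_nonneg ht zero_le_one
  have hvK' : Q v (K • 1) := hQ.mono _ _ hv fun s => by simpa using hvK s
  have h0v : Q ((0 : ℝ) • 1) v := hQ.mono _ _ (hc le_rfl) (by simpa using hv)
  -- `Q` prefers small vectors, so T consists of the constants that lie weakly below v in value; its
  -- supremum is the equivalent.
  set T := {t : ℝ | 0 ≤ t ∧ Q (t • 1) v} with hT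
  have hTK : ∀ t ∈ T, t ≤ K := fun t ht =>
    (hQ.const_iff ht.1 hK).1 (hQ.trans _ _ _ (hc ht.1) hv (hc hK) ht.2 hvK')
  have hTne : T.Nonempty := ⟨0, le_rfl, h0v⟩
  have hTb : BddAbove T := ⟨K, hTK⟩
  have ht0 : 0 ≤ sSup T := le_csSup hTb ⟨le_rfl, h0v⟩
  have htK : sSup T ≤ K := csSup_le hTne hTK
  set t := sSup T with ht
  refine ⟨t, ht0, ?_, ?_⟩
  · by_contra h
    -- If t were strictly below v in value, continuity between t and K + 1 would give a larger
    -- element of T.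
    have hK1 : ¬ Q ((K + 1) • 1) v := fun h' => by
      have := (hQ.const_iff (by linarith) hK).1
        (hQ.trans _ _ _ (hc (by linarith)) hv (hc hK) h' hvK')
      linarith
    obtain ⟨q, -, ⟨hq, hq1⟩, -, hqv, -⟩ := hQ.cont _ _ _ (hc ht0) hv (hc (by linarith)) h hK1
    rw [smul_smul, smul_smul, ← add_smul] at hqv
    have hnn : 0 ≤ q * t + (1 - q) * (K + 1) :=
      add_nonneg (mul_nonneg hq.le ht0) (mul_nonneg (by linarith) (by linarith))
    have := le_csSup hTb ⟨hnn, (hQ.total _ _ hv (hc hnn)).resolve_left hqv⟩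
    nlinarith
  · by_contra h
    have htpos : 0 < t := by
      rcases ht0.eq_or_lt with h0 | h0
      · exact absurd (h0 ▸ h0v) h
      · exact h0
    have hv0 : ¬ Q v ((0 : ℝ) • 1) := by
      intro h'
      obtain ⟨a, ha, ha'⟩ := exists_lt_of_lt_csSup hTne htpos
      have := (hQ.const_iff ha.1 le_rfl).1 (hQ.trans _ _ _ (hc ha.1) hv (hc le_rfl) ha.2 h')
      linarith
    -- If t were strictly above v, so would be some (1 - r) t < t, contradicting the elements of T
    -- beyond it.
    obtain ⟨-, r, -, ⟨hr, hr1⟩, -, hrv⟩ := hQ.cont _ _ _ (hc le_rfl) hv (hc ht0) hv0 h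
    rw [smul_smul, smul_smul, ← add_smul, mul_zero, zero_add] at hrv
    have hnn : 0 ≤ (1 - r) * t := mul_nonneg (by linarith) ht0
    obtain ⟨a, ha, ha'⟩ := exists_lt_of_lt_csSup hTne (show (1 - r) * t < t by nlinarith)
    exact hrv (hQ.trans _ _ _ (hc hnn) (hc ha.1) hv
      ((hQ.const_iff hnn ha.1).2 ha'.le) ha.2)

/-- A regret order is represented by an upper expectation. -/
theorem exists_upperExpectation [Finite S] : ∃ N : (S → ℝ) → ℝ, IsUpperExpectation N ∧ N 1 = 1 ∧
    ∀ v w, 0 ≤ v → 0 ≤ w → (Q v w ↔ N v ≤ N w) := by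
  have hc : ∀ {t : ℝ}, 0 ≤ t → (0 : S → ℝ) ≤ t • 1 := fun ht => smul_nonneg ht zero_le_one
  choose! N hN0 hN hN' using fun (v : S → ℝ) (hv : 0 ≤ v) => hQ.exists_const_equiv hv
  have rep : ∀ v w, 0 ≤ v → 0 ≤ w → (Q v w ↔ N v ≤ N w) := by
    intro v w hv hw
    rw [← hQ.const_iff (hN0 v hv) (hN0 w hw)]
    constructor
    · exact fun h => hQ.trans _ _ _ (hc (hN0 v hv)) hv (hc (hN0 w hw)) (hN' v hv)
        (hQ.trans _ _ _ hv hw (hc (hN0 w hw)) h (hN w hw))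
    · exact fun h => hQ.trans _ _ _ hv (hc (hN0 v hv)) hw (hN v hv)
        (hQ.trans _ _ _ (hc (hN0 v hv)) (hc (hN0 w hw)) hw h (hN' w hw))
  have huniq : ∀ v t, 0 ≤ v → 0 ≤ t → Q v (t • 1) → Q (t • 1) v → N v = t := by
    intro v t hv ht h h'
    apply le_antisymm
    · exact (hQ.const_iff (hN0 v hv) ht).1
        (hQ.trans _ _ _ (hc (hN0 v hv)) hv (hc ht) (hN' v hv) h)
    · exact (hQ.const_iff ht (hN0 v hv)).1
        (hQ.trans _ _ _ (hc ht) hv (hc (hN0 v hv)) h' (hN v hv))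
  have hconst : ∀ t, 0 ≤ t → N (t • 1) = t := fun t ht =>
    huniq _ t (hc ht) ht (hQ.mono _ _ (hc ht) le_rfl) (hQ.mono _ _ (hc ht) le_rfl)
  have hone : N 1 = 1 := by simpa using hconst 1 zero_le_one
  have hmono : ∀ v w, 0 ≤ v → v ≤ w → N v ≤ N w := fun v w hv h =>
    (rep v w hv (hv.trans h)).1 (hQ.mono v w hv h)
  have hsmul : ∀ (c : ℝ) v, 0 ≤ c → 0 ≤ v → N (c • v) = c * N v := by
    intro c v hc0 hv
    rcases hc0.eq_or_lt with rfl | hc0'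
    · simpa using hconst 0 le_rfl
    · refine huniq _ _ (smul_nonneg hc0 hv) (mul_nonneg hc0 (hN0 v hv)) ?_ ?_
      · rw [mul_smul]
        exact hQ.smul c _ _ hc0' hv (hc (hN0 v hv)) (hN v hv)
      · rw [mul_smul]
        exact hQ.smul c _ _ hc0' (hc (hN0 v hv)) hv (hN' v hv)
  have hquasi : ∀ (p : ℝ) v w, 0 < p → p < 1 → 0 ≤ v → 0 ≤ w → N v = N w →
      N (p • v + (1 - p) • w) ≤ N w := by
    intro p v w hp hp1 hv hw h
    exact (rep _ _ (add_nonneg (smul_nonneg hp.le hv) (smul_nonneg (by linarith) hw)) hw).1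
      (hQ.convex p v w hp hp1 hv hw ((rep v w hv hw).2 h.le) ((rep w v hw hv).2 h.ge))
  have hadd_pos : ∀ v w, 0 ≤ v → 0 ≤ w → 0 < N v → 0 < N w → N (v + w) ≤ N v + N w := by
    intro v w hv hw ha hb
    set a := N v with hadef
    set b := N w with hbdef
    have hab : 0 < a + b := by linarith
    -- Both b v and a w have value a b, so quasiconvexity applies to them; this mixture is a
    -- multiple of v + w.
    have h := hquasi (a / (a + b)) (b • v) (a • w) (by positivity)
      (by rw [div_lt_one hab]; linarith) (smul_nonneg hb.le hv) (smul_nonneg ha.le hw)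
      (by rw [hsmul _ _ hb.le hv, hsmul _ _ ha.le hw, mul_comm])
    have h1 : (a / (a + b)) • b • v + (1 - a / (a + b)) • a • w = (a * b / (a + b)) • (v + w) := by
      match_scalars <;> field_simp
      ring
    rw [h1, hsmul _ _ (by positivity) (add_nonneg hv hw), hsmul _ _ ha.le hw, ← hbdef,
      div_mul_eq_mul_div, div_le_iff₀ hab, mul_assoc] at h
    nlinarith [mul_pos ha hb]
  have hadd_zero : ∀ v w, 0 ≤ v → 0 ≤ w → N v = 0 → 0 < N w → N (v + w) ≤ N w := by
    intro v w hv hw hv0 hb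
    by_contra! hlt
    set b := N w with hbdef
    set δ := N (v + w) - b with hδ
    have hδ0 : 0 < δ := sub_pos.2 hlt
    -- Rescaling to equal values fails when N v = 0. Instead, continuity gives a mixture q v + (1 -
    -- q) w of value below m: m ≤ b/2 forces q > 1/2, and m ≤ δ/2 yields the contradiction.
    set m := min δ b / 2 with hm
    have hm0 : 0 < m := by positivity
    have hmδ : m ≤ δ / 2 := by rw [hm]; gcongr; exact min_le_left _ _
    have hmb : m ≤ b / 2 := by rw [hm]; gcongr; exact min_le_right _ _
    obtain ⟨q, -, ⟨hq, hq1⟩, -, hqm, -⟩ := hQ.cont v (m • 1) w hv (hc hm0.le) hw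
      (by rw [rep _ _ (hc hm0.le) hv, hconst m hm0.le, hv0]; linarith)
      (by rw [rep _ _ hw (hc hm0.le), hconst m hm0.le]; linarith)
    have h1q : 0 < 1 - q := by linarith
    have hnn : 0 ≤ q • v + (1 - q) • w := add_nonneg (smul_nonneg hq.le hv) (smul_nonneg h1q.le hw)
    rw [rep _ _ (hc hm0.le) hnn, hconst m hm0.le, not_le] at hqm
    have h2 : (1 - q) * b ≤ N (q • v + (1 - q) • w) := by
      rw [hbdef, ← hsmul _ _ h1q.le hw]
      exact hmono _ _ (smul_nonneg h1q.le hw) (le_add_of_nonneg_left (smul_nonneg hq.le hv))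
    have hq2 : 1 / 2 < q := by nlinarith
    -- write `q (v + w)` as the sum of the mixture and of a multiple of `w`
    have h3 := hadd_pos (q • v + (1 - q) • w) ((2 * q - 1) • w) hnn
      (smul_nonneg (by linarith) hw) (lt_of_lt_of_le (by positivity) h2)
      (by rw [hsmul _ _ (by linarith) hw]; exact mul_pos (by linarith) hb)
    have h4 : q • v + (1 - q) • w + (2 * q - 1) • w = q • (v + w) := by module
    rw [h4, hsmul _ _ hq.le (add_nonneg hv hw), hsmul _ _ (by linarith) hw, ← hbdef] at h3
    nlinarith
  refine ⟨N, ⟨hmono, fun v w hv hw => ?_, hsmul, by rw [hone]; exact one_pos⟩, hone, rep⟩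
  rcases (hN0 v hv).eq_or_lt with ha | ha <;> rcases (hN0 w hw).eq_or_lt with hb | hb
  · have h := hquasi (1 / 2) v w (by norm_num) (by norm_num) hv hw (by rw [← ha, ← hb])
    have h1 : (1 / 2 : ℝ) • v + (1 - 1 / 2 : ℝ) • w = (1 / 2 : ℝ) • (v + w) := by module
    rw [h1, hsmul _ _ (by norm_num) (add_nonneg hv hw)] at h
    linarith
  · rw [← ha, zero_add]
    exact hadd_zero v w hv hw ha.symm hb
  · rw [← hb, add_zero, add_comm]
    exact hadd_zero w v hw hv hb.symm ha
  · exact hadd_pos v w hv hw ha hb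

end IsRegretOrder

/-! ### Upper expectations and regular sets of sub-probabilities -/

variable [Fintype S]

/-- The sub-probabilities whose expectations are dominated by `N`. -/
def dominated (N : (S → ℝ) → ℝ) : Set (S → ℝ) :=
  {q | 0 ≤ q ∧ ∀ v : S → ℝ, 0 ≤ v → ∑ s, q s * v s ≤ N v}

lemma isRegular_dominated (N : (S → ℝ) → ℝ) : IsRegular (dominated N) where
  convex := by
    rintro q ⟨hq, hq'⟩ r ⟨hr, hr'⟩ a b ha hb hab
    refine ⟨add_nonneg (smul_nonneg ha hq) (smul_nonneg hb hr), fun v hv => ?_⟩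
    have h1 := mul_le_mul_of_nonneg_left (hq' v hv) ha
    have h2 := mul_le_mul_of_nonneg_left (hr' v hv) hb
    have h3 : ∑ s, (a • q + b • r) s * v s = a * ∑ s, q s * v s + b * ∑ s, r s * v s := by
      rw [Finset.mul_sum, Finset.mul_sum, ← Finset.sum_add_distrib]
      exact Finset.sum_congr rfl fun s _ => by simp; ring
    rw [h3]
    calc _ ≤ a * N v + b * N v := add_le_add h1 h2
      _ = N v := by rw [← add_mul, hab, one_mul]
  closed := by
    have : dominated N = {q | 0 ≤ q} ∩ ⋂ v ∈ {v : S → ℝ | 0 ≤ v}, {q | ∑ s, q s * v s ≤ N v} := by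
      ext q
      simp [dominated]
    rw [this]
    exact isClosed_Ici.inter (isClosed_biInter fun v _ =>
      isClosed_le (by fun_prop) continuous_const)
  downward := by
    rintro p ⟨-, hp'⟩ q hq hqp
    refine ⟨hq, fun v hv => le_trans ?_ (hp' v hv)⟩
    exact Finset.sum_le_sum fun s _ => mul_le_mul_of_nonneg_right (hqp s) (hv s)

lemma sum_smul_mul (a : ℝ) (p v : S → ℝ) : ∑ s, (a • p) s * v s = a * ∑ s, p s * v s := by
  simp [Finset.mul_sum, mul_assoc]

namespace IsUpperExpectation

variable {N : (S → ℝ) → ℝ} (hN : IsUpperExpectation N)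
include hN

/-- The upper expectation of a vector is attained by a dominated sub-probability. -/
lemma exists_dominated_eq {v : S → ℝ} (hv : 0 ≤ v) : ∃ q ∈ dominated N, ∑ s, q s * v s = N v := by
  classical
  rcases eq_or_ne v 0 with rfl | hv0
  · refine ⟨0, ⟨le_rfl, fun w hw => by simpa using hN.nonneg hw⟩, by simp [hN.zero]⟩
  have hpos : ∀ x : S → ℝ, (0 : S → ℝ) ≤ fun s => max (x s) 0 := fun x s => le_max_right _ _
  -- Hahn–Banach for t v ↦ t N(v), with N of the positive part as the sublinear bound on all of ℝ^S.
  obtain ⟨g, hg, hgN⟩ := exists_extension_of_le_sublinear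
    (LinearPMap.mkSpanSingleton' (σ := RingHom.id ℝ) v (N v) fun c hc => by
      rw [(smul_eq_zero.1 hc).resolve_right hv0]; simp)
    (fun x => N fun s => max (x s) 0)
    (by
      intro c hc x
      rw [← hN.smul _ _ hc.le (hpos x)]
      congr 1
      funext s
      simp [mul_max_of_nonneg _ _ hc.le])
    (by
      intro x y
      refine le_trans (hN.mono _ _ (hpos _) fun s => ?_) (hN.add_le _ _ (hpos x) (hpos y))
      have h1 := le_max_left (x s) 0
      have h2 := le_max_left (y s) 0
      have h3 := le_max_right (x s) 0
      have h4 := le_max_right (y s) 0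
      exact max_le (add_le_add h1 h2) (add_nonneg h3 h4))
    (by
      rintro ⟨x, hx⟩
      obtain ⟨t, rfl⟩ := Submodule.mem_span_singleton.1 hx
      refine le_of_eq_of_le (LinearPMap.mkSpanSingleton'_apply (σ := RingHom.id ℝ) v (N v) _ t hx) ?_
      simp only [RingHom.id_apply, smul_eq_mul]
      rcases le_total 0 t with ht | ht
      · rw [← hN.smul _ _ ht hv]
        exact hN.mono _ _ (smul_nonneg ht hv) fun s => le_max_left _ _
      · exact (mul_nonpos_of_nonpos_of_nonneg ht (hN.nonneg hv)).trans (hN.nonneg (hpos _)))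
  have hsum : ∀ x, ∑ s, g (Pi.single s 1) * x s = g x := by
    intro x
    have hx : x = ∑ s, x s • Pi.single s (1 : ℝ) := by
      funext t
      simp [Pi.single_apply]
    conv_rhs => rw [hx]
    simp [map_sum, mul_comm]
  refine ⟨fun s => g (Pi.single s 1), ⟨fun s => ?_, fun w hw => ?_⟩, ?_⟩
  -- The positive part of a negative unit vector is 0, so the coefficients of g are nonnegative.
  · have h := hgN (-Pi.single s 1)
    have h1 : (fun t => max ((-Pi.single s (1 : ℝ) : S → ℝ) t) 0) = 0 := by
      funext t
      have : (0 : S → ℝ) ≤ Pi.single s (1 : ℝ) := Pi.single_nonneg.2 zero_le_one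
      simpa using this t
    rw [h1, hN.zero, map_neg] at h
    exact neg_nonpos.1 h
  · rw [hsum]
    refine (hgN w).trans_eq ?_
    congr 1
    funext s
    exact max_eq_left (hw s)
  · rw [hsum]
    refine (hg ⟨v, Submodule.mem_span_singleton_self v⟩).trans ?_
    exact LinearPMap.mkSpanSingleton'_apply_self _ _ _ _

end IsUpperExpectation

lemma IsWeightedSet.sum_le_of_mem_subProbs {P : Set ((S → ℝ) × ℝ)} (hP : IsWeightedSet P)
    {q : S → ℝ} (hq : q ∈ subProbs P) {v : S → ℝ} (hv : 0 ≤ v) :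
    ∑ s, q s * v s ≤ upperExp P v := by
  obtain ⟨x, hx, a, -, hax, rfl⟩ := hq
  rw [sum_smul_mul]
  exact (mul_le_mul_of_nonneg_right hax (hP.sum_nonneg hx hv)).trans (hP.le_upperExp hv hx)

lemma IsWeightedSet.subProbs_nonneg {P : Set ((S → ℝ) × ℝ)} (hP : IsWeightedSet P)
    {q : S → ℝ} (hq : q ∈ subProbs P) : 0 ≤ q := by
  obtain ⟨x, hx, a, ha, -, rfl⟩ := hq
  exact smul_nonneg ha fun s => (hP.prob x hx).1 s

/-- A regular set `C(P)` is determined by its upper expectation. -/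
lemma IsWeightedSet.subProbs_eq_dominated {P : Set ((S → ℝ) × ℝ)} (hP : IsWeightedSet P)
    (hC : IsRegular (subProbs P)) : subProbs P = dominated (upperExp P) := by
  classical
  refine subset_antisymm (fun q hq => ⟨hP.subProbs_nonneg hq, fun v hv =>
    hP.sum_le_of_mem_subProbs hq hv⟩) ?_
  rintro q ⟨hq, hqN⟩
  by_contra hqC
  obtain ⟨f, u, hfu, huq⟩ := geometric_hahn_banach_closed_point hC.convex hC.closed hqC
  have hsum : ∀ x : S → ℝ, f x = ∑ s, x s * f (Pi.single s 1) := by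
    intro x
    have hx : x = ∑ s, x s • Pi.single s (1 : ℝ) := by
      funext t
      simp [Pi.single_apply]
    conv_lhs => rw [hx]
    simp [map_sum]
  set w : S → ℝ := fun s => f (Pi.single s 1) with hw
  have hw0 : (0 : S → ℝ) ≤ fun s => max (w s) 0 := fun s => le_max_right _ _
  have h1 : upperExp P (fun s => max (w s) 0) ≤ u := by
    refine hP.upperExp_le fun x hx => ?_
    have hx0 : (0 : S → ℝ) ≤ x.2 • x.1 := smul_nonneg (hP.weight x hx).1 (hP.prob x hx).1
    -- Downward closure allows coordinates with w ≤ 0 to be set to zero, so the separating w may be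
    -- replaced by its positive part, a vector on which N is defined.
    have hmem : {s | 0 < w s}.indicator (x.2 • x.1) ∈ subProbs P :=
      hC.downward (x.2 • x.1) ⟨x, hx, x.2, (hP.weight x hx).1, le_rfl, rfl⟩ _
        (indicator_nonneg_vec _ hx0) (indicator_le_self' fun s _ => hx0 s)
    have := (hfu _ hmem).le
    rw [hsum] at this
    rw [← sum_smul_mul]
    refine le_of_eq_of_le (Finset.sum_congr rfl fun s _ => ?_) this
    by_cases hs : 0 < w s
    · rw [max_eq_left hs.le, indicator_of_mem (by exact hs)]
    · rw [max_eq_right (not_lt.1 hs), indicator_of_notMem (by exact hs), mul_zero, zero_mul]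
  have h2 : f q ≤ ∑ s, q s * max (w s) 0 := by
    rw [hsum]
    exact Finset.sum_le_sum fun s _ => mul_le_mul_of_nonneg_left (le_max_left _ _) (hq s)
  have h3 := hqN _ hw0
  linarith

/-- Every normalized upper expectation is that of a weighted set of probabilities, which can be
chosen regular. -/
theorem IsUpperExpectation.exists_weightedSet {N : (S → ℝ) → ℝ} (hN : IsUpperExpectation N)
    (h1 : N 1 = 1) : ∃ P : Set ((S → ℝ) × ℝ), IsWeightedSet P ∧ IsRegular (subProbs P) ∧
      ∀ v, 0 ≤ v → upperExp P v = N v := by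
  have hreg := isRegular_dominated N
  have h0 : (0 : S → ℝ) ∈ dominated N := ⟨le_rfl, fun v hv => by simpa using hN.nonneg hv⟩
  have hle : ∀ p ∈ stdSimplex ℝ S, ∀ a ∈ {a : ℝ | 0 ≤ a ∧ a • p ∈ dominated N}, a ≤ 1 := by
    rintro p hp a ⟨-, ha⟩
    have := ha.2 1 zero_le_one
    rw [sum_smul_mul, h1] at this
    simpa [hp.2] using this
  have hbdd : ∀ p ∈ stdSimplex ℝ S, BddAbove {a : ℝ | 0 ≤ a ∧ a • p ∈ dominated N} :=
    fun p hp => ⟨1, hle p hp⟩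
  have hne : ∀ p : S → ℝ, {a : ℝ | 0 ≤ a ∧ a • p ∈ dominated N}.Nonempty :=
    fun p => ⟨0, le_rfl, by simpa using h0⟩
  -- The weight of p is the largest multiple of p in the dominated set, attained because that set is
  -- closed. Every probability receives a weight, possibly 0.
  set α : (S → ℝ) → ℝ := fun p => sSup {a : ℝ | 0 ≤ a ∧ a • p ∈ dominated N} with hα
  have hmem : ∀ p ∈ stdSimplex ℝ S, 0 ≤ α p ∧ α p • p ∈ dominated N := by
    intro p hp
    refine IsClosed.csSup_mem (s := {a : ℝ | 0 ≤ a ∧ a • p ∈ dominated N}) ?_ (hne p) (hbdd p hp)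
    exact isClosed_Ici.inter (hreg.closed.preimage (by fun_prop : Continuous fun a : ℝ => a • p))
  have hα1 : ∀ p ∈ stdSimplex ℝ S, α p ≤ 1 := fun p hp => csSup_le (hne p) (hle p hp)
  set P : Set ((S → ℝ) × ℝ) := {x | x.1 ∈ stdSimplex ℝ S ∧ x.2 = α x.1} with hPdef
  have hP : IsWeightedSet P := by
    refine ⟨fun x hx => hx.1, fun x hx => ?_, fun x hx y hy hxy => ?_, ?_⟩
    · rw [hx.2]
      exact ⟨(hmem _ hx.1).1, hα1 _ hx.1⟩
    · rw [hx.2, hy.2, hxy]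
    -- A dominated vector of total mass N(1) = 1 is a probability of weight 1.
    · obtain ⟨q, hq, hqN⟩ := hN.exists_dominated_eq (v := 1) zero_le_one
      have hqs : q ∈ stdSimplex ℝ S := ⟨hq.1, by simpa [h1] using hqN⟩
      refine ⟨(q, α q), ⟨hqs, rfl⟩, le_antisymm (hα1 q hqs) ?_⟩
      exact le_csSup (hbdd q hqs) ⟨zero_le_one, by simpa using hq⟩
  have hsub : subProbs P = dominated N := by
    refine subset_antisymm ?_ ?_
    · rintro _ ⟨x, hx, a, ha, hax, rfl⟩
      rw [hx.2] at hax
      exact hreg.downward _ (hmem _ hx.1).2 _ (smul_nonneg ha hx.1.1)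
        (smul_le_smul_of_nonneg_right hax hx.1.1)
    · intro q hq
      rcases (Finset.sum_nonneg fun s _ => hq.1 s : 0 ≤ ∑ s, q s).eq_or_lt with h | h
      · obtain ⟨x, hx, -⟩ := hP.normalized
        refine ⟨x, hx, 0, le_rfl, (hP.weight x hx).1, ?_⟩
        funext s
        simpa using (Finset.sum_eq_zero_iff_of_nonneg fun s _ => hq.1 s).1 h.symm s
          (Finset.mem_univ s)
      · have hqs : (∑ s, q s)⁻¹ • q ∈ stdSimplex ℝ S :=
          ⟨smul_nonneg (by positivity) hq.1, by
            simp [← Finset.mul_sum, inv_mul_cancel₀ h.ne']⟩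
        refine ⟨((∑ s, q s)⁻¹ • q, α ((∑ s, q s)⁻¹ • q)), ⟨hqs, rfl⟩, ∑ s, q s, h.le,
          le_csSup (hbdd _ hqs) ⟨h.le, ?_⟩, ?_⟩
        · rwa [smul_inv_smul₀ h.ne']
        · rw [smul_inv_smul₀ h.ne']
  refine ⟨P, hP, hsub ▸ hreg, fun v hv => le_antisymm ?_ ?_⟩
  · refine hP.upperExp_le fun x hx => ?_
    rw [hx.2, ← sum_smul_mul]
    exact (hmem _ hx.1).2.2 v hv
  · obtain ⟨q, hq, hqN⟩ := hN.exists_dominated_eq hv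
    rw [← hqN]
    exact hP.sum_le_of_mem_subProbs (hsub ▸ hq) hv

end

section

variable {S Y : Type*} {𝓜 : Set (Set (Act S Y))} {R : MenuPref S Y} {U : Y → ℝ}

/-! ### Representation of menu-dependent preferences -/

/-- A preference relation that satisfies the axioms has a von Neumann–Morgenstern utility. -/
lemma Axioms.exists_util (hA : Axioms 𝓜 R) (h𝓜 : IsMenuCollection 𝓜) :
    ∃ U, AxiomsWithUtil 𝓜 R U := by
  obtain ⟨l, l', h⟩ := hA.exists_not_constPref
  obtain ⟨U, hU⟩ := (hA.isVNM h𝓜).exists_util h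
  exact ⟨U, h𝓜, hA, hU, l, l', by rwa [hU, not_le] at h⟩

lemma exists_ne_of_util_lt {l l' : Lottery Y} (h : util U l < util U l') :
    ∃ y₁ y₂, U y₁ ≠ U y₂ := by
  by_contra! hc
  obtain ⟨y⟩ := l.nonempty
  have hU : U = fun z => 0 * U z + U y := by
    funext z
    rw [zero_mul, zero_add, hc z y]
  rw [hU, util_affine, util_affine] at h
  simp at h

namespace AxiomsWithUtil

variable (hA : AxiomsWithUtil 𝓜 R U)
include hA

lemma menusBounded : MenusBounded 𝓜 U := by
  intro M hM
  obtain ⟨l, hl⟩ := hA.ax.boundedness M hM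
  exact ⟨l, fun f hf s => (hA.constPref_iff _ _).1 (hl f hf s)⟩

/-- Adding an act that attains the best utility in every state does not change preferences. -/
lemma exists_top (hbest : (∀ M ∈ 𝓜, HasBestOutcomes R M) ∨ LimitINA 𝓜 R) {M : Set (Act S Y)}
    (hM : M ∈ 𝓜) : ∃ k : Act S Y,
      (∀ s, IsLUB ((fun g : Act S Y => util U (g s)) '' M) (util U (k s))) ∧
      ∀ f ∈ M, ∀ g ∈ M, (R M f g ↔ R (M ∪ {k}) f g) := by
  have hk𝓜 : ∀ k : Act S Y, {k} ∈ 𝓜 := fun k =>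
    hA.menus.finite _ (toFinite _) ⟨k, rfl⟩
  rcases hbest with h | h
  · choose F hF hFM using h M hM
    -- The added act takes in each state the outcome of the act that is best there.
    refine ⟨fun s => F s s, fun s => IsGreatest.isLUB ⟨⟨F s, hF s, rfl⟩, ?_⟩,
      hA.ax.ina M hM _ (hk𝓜 _) ?_⟩
    · rintro _ ⟨g, hg, rfl⟩
      exact (hA.constPref_iff _ _).1 (hFM s g hg)
    · rintro _ rfl s
      exact ⟨F s, hF s, (hA.constPref_iff _ _).2 le_rfl⟩
  · have hne := hA.menus.nonempty M hM
    have hb := hA.menusBounded.utilBounded hM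
    obtain ⟨l, hl⟩ := hA.menusBounded M hM
    obtain ⟨f, hf⟩ := hne
    -- The supremum may not be attained in M, but it lies between the utilities of two lotteries.
    have hex : ∀ s, ∃ m : Lottery Y,
        util U m = sSup ((fun g : Act S Y => util U (g s)) '' M) := fun s =>
      exists_util_eq (le_csSup (hb s) ⟨f, hf, rfl⟩)
        (csSup_le ⟨_, f, hf, rfl⟩ (by rintro _ ⟨g, hg, rfl⟩; exact hl g hg s))
    choose k hk using hex
    refine ⟨k, fun s => hk s ▸ hb.isLUB ⟨f, hf⟩ s, h M hM _ (hk𝓜 k) ?_⟩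
    rintro _ rfl s m hm
    rw [hA.constPref_iff, hk]
    refine csSup_le ⟨_, f, hf, rfl⟩ ?_
    rintro _ ⟨g, hg, rfl⟩
    exact (hA.constPref_iff _ _).1 (hm g hg)

/-- The axioms imply that preferences minimize an upper expectation of regret. -/
theorem exists_minimizesRegret [Finite S]
    (hbest : (∀ M ∈ 𝓜, HasBestOutcomes R M) ∨ LimitINA 𝓜 R) :
    ∃ N : (S → ℝ) → ℝ, IsUpperExpectation N ∧ N 1 = 1 ∧ MinimizesRegret 𝓜 R U N := by
  obtain ⟨N, hN, hN1, hrep⟩ := hA.isRegretOrder.exists_upperExpectation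
  refine ⟨N, hN, hN1, fun M hM f hf g hg => ?_⟩
  have hb := hA.menusBounded.utilBounded hM
  obtain ⟨k, hk, hkM⟩ := hA.exists_top hbest hM
  have hreg : ∀ (f : Act S Y) s, util U (k s) - util U (f s) = 1 * regret U M f s := fun f s => by
    rw [one_mul, regret_eq_of_isLUB (hA.menus.nonempty M hM) (hk s)]
  rw [← hrep _ _ (regret_nonneg hb hf) (regret_nonneg hb hg), hkM f hf g hg,
    hA.regretPref_iff (hA.menus.insert_mem hM k) (.inr rfl) (.inl hf) (.inl hg) ?_ one_pos
      (hreg f) (hreg g)]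
  rintro h (hh | rfl) s
  · exact (hk s).1 ⟨h, hh, rfl⟩
  · exact le_rfl

end AxiomsWithUtil

/-- The normalized upper expectation of a regret-minimizing preference is unique. -/
lemma MinimizesRegret.eq_of_one [Finite S] {N N' : (S → ℝ) → ℝ} (h𝓜 : IsMenuCollection 𝓜)
    (hU : ∃ l l', util U l < util U l') (hR : MinimizesRegret 𝓜 R U N)
    (hR' : MinimizesRegret 𝓜 R U N') (hN : IsUpperExpectation N) (hN' : IsUpperExpectation N')
    (h1 : N 1 = 1) (h1' : N' 1 = 1) {v : S → ℝ} (hv : 0 ≤ v) : N v = N' v := by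
  -- Acts with regrets proportional to v and to the constant N'(v) are indifferent by N', hence by
  -- N, which values that constant at N'(v).
  have hw : (0 : S → ℝ) ≤ N' v • 1 := smul_nonneg (hN'.nonneg hv) zero_le_one
  obtain ⟨K, hK, hvK, hwK, -⟩ := exists_bound v (N' v • 1) v
  obtain ⟨c, hc, l, hl, -⟩ := exists_scaled_acts (S := S) hU hK
  obtain ⟨f, hf⟩ := hl v hv hvK
  obtain ⟨g, hg⟩ := hl _ hw hwK
  have hM := h𝓜.triple_mem (const l : Act S Y) f g
  have htop : ∀ e ∈ ({const l, f, g} : Set (Act S Y)), ∀ s,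
      util U (e s) ≤ util U ((const l : Act S Y) s) := by
    rintro e (rfl | rfl | rfl) s
    · exact le_rfl
    · have := hf s; have := mul_nonneg hc.le (hv s); simp only [const_apply]; linarith
    · have := hg s; have := mul_nonneg hc.le (hw s); simp only [const_apply]; linarith
  have hrf : regret U {const l, f, g} f = c • v := funext fun s => by
    rw [regret_eq_of_top (k := const l) (by simp) htop, const_apply, hf]; rfl
  have hrg : regret U {const l, f, g} g = c • N' v • 1 := funext fun s => by
    rw [regret_eq_of_top (k := const l) (by simp) htop, const_apply, hg]; rfl
  have hi := hR'.indiff_iff hM (f := f) (g := g) (by simp) (by simp)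
  rw [hR.indiff_iff hM (by simp) (by simp), hrf, hrg, hN.smul _ _ hc.le hv, hN.smul _ _ hc.le hw,
    hN.smul _ _ (hN'.nonneg hv) zero_le_one, h1, hN'.smul _ _ hc.le hv, hN'.smul _ _ hc.le hw,
    hN'.smul _ _ (hN'.nonneg hv) zero_le_one, h1', mul_one] at hi
  exact mul_left_cancel₀ hc.ne' (hi.2 rfl)

lemma MinimizesRegret.affine_iff {N : (S → ℝ) → ℝ} (hN : IsUpperExpectation N)
    (h𝓜 : IsMenuCollection 𝓜) (hB : MenusBounded 𝓜 U) {a : ℝ} (ha : 0 < a) (b : ℝ) :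
    MinimizesRegret 𝓜 R (fun y => a * U y + b) N ↔ MinimizesRegret 𝓜 R U N := by
  refine forall₂_congr fun M hM => forall₂_congr fun f hf => forall₂_congr fun g hg => ?_
  have hb := hB.utilBounded hM
  rw [regret_affine hb (h𝓜.nonempty M hM) ha, regret_affine hb (h𝓜.nonempty M hM) ha,
    hN.smul _ _ ha.le (regret_nonneg hb hf), hN.smul _ _ ha.le (regret_nonneg hb hg),
    mul_le_mul_iff_right₀ ha]

lemma MenusBounded.affine (hB : MenusBounded 𝓜 U) {a : ℝ} (ha : 0 < a) (b : ℝ) :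
    MenusBounded 𝓜 fun y => a * U y + b := by
  intro M hM
  obtain ⟨l, hl⟩ := hB M hM
  refine ⟨l, fun f hf s => ?_⟩
  rw [util_affine, util_affine]
  have := mul_le_mul_of_nonneg_left (hl f hf s) ha.le
  linarith

/-- Splicing on the whole space changes nothing, so any strict preference witnesses non-nullity. -/
lemma Axioms.nonNull_univ (hA : Axioms 𝓜 R) : NonNull 𝓜 R univ := by
  intro h
  obtain ⟨M, hM, f, hf, g, hg, -, hn⟩ := hA.nontriviality
  have hs : splice f univ g = f := by
    funext s
    simp [splice]
  have := h f g M hM (by rwa [hs]) hg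
  rw [hs] at this
  exact hn this.2

/-! ### Conditional preferences, existence and uniqueness -/

variable [Fintype S] {T : CondPref S Y} {P : Set ((S → ℝ) × ℝ)}

/-- By dynamic consistency, a representation of the unconditional preferences extends to the
conditional ones. -/
lemma MDC.represents (hT : MDC 𝓜 T) (h𝓜 : IsMenuCollection 𝓜) (hU : ∃ y₁ y₂, U y₁ ≠ U y₂)
    (hB : MenusBounded 𝓜 U) (hP : IsWeightedSet P)
    (hR : MinimizesRegret 𝓜 (T univ) U (upperExp P)) : Represents 𝓜 T U P where
  bounded := hB
  pref E hE := by
    have hlik : 0 < upperLik P E := by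
      rwa [upperLik_eq, ← hR.nonNull_iff hP.isUpperExpectation h𝓜 hU hB]
    refine ⟨hlik, fun M hM f hf g hg => ?_⟩
    have key : ∀ h ∈ M, (T univ (spliceMenu M E h) (splice f E h) (splice g E h) ↔
        mwerPref U (update P E) M f g) := by
      intro h hh
      rw [hP.mwerPref_update_iff hlik (hB.utilBounded hM) hf hg,
        hR _ (h𝓜.splice M hM E h hh) _ ⟨f, hf, rfl⟩ _ ⟨g, hg, rfl⟩,
        regret_spliceMenu ⟨f, hf⟩, regret_spliceMenu ⟨f, hf⟩]
    rw [hT E hE M hM f hf g hg]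
    constructor
    · rintro ⟨h, hh, h'⟩
      exact (key h hh).1 h'
    · exact fun h => ⟨f, hf, (key f hf).2 h⟩

lemma Represents.minimizesRegret (hT : Represents 𝓜 T U P) (hP : IsWeightedSet P)
    (hnull : NonNull 𝓜 (T univ) univ) : MinimizesRegret 𝓜 (T univ) U (upperExp P) := by
  intro M hM f hf g hg
  obtain ⟨hlik, h⟩ := hT.pref univ hnull
  rw [h M hM f hf g hg, hP.mwerPref_update_iff hlik (hT.bounded.utilBounded hM) hf hg,
    indicator_univ, indicator_univ]

/-- The axioms and dynamic consistency characterize the existence of a representation by regular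
weighted sets of probabilities with likelihood updating, and the representation is unique. -/
theorem exists_represents (h𝓜 : IsMenuCollection 𝓜) (hA : Axioms 𝓜 (T univ)) (hT : MDC 𝓜 T)
    (hbest : (∀ M ∈ 𝓜, HasBestOutcomes (T univ) M) ∨ LimitINA 𝓜 (T univ)) :
    ∃ (U : Y → ℝ) (P : Set ((S → ℝ) × ℝ)), IsWeightedSet P ∧ IsRegular (subProbs P) ∧
      Represents 𝓜 T U P ∧
      (∀ a b : ℝ, 0 < a → Represents 𝓜 T (fun y => a * U y + b) P) ∧
      ∀ (V : Y → ℝ) (Q : Set ((S → ℝ) × ℝ)), IsWeightedSet Q → Represents 𝓜 T V Q →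
        (∃ a b : ℝ, 0 < a ∧ V = fun y => a * U y + b) ∧
        (IsRegular (subProbs Q) → subProbs Q = subProbs P) := by
  obtain ⟨U, hAU⟩ := hA.exists_util h𝓜
  obtain ⟨N, hN, hN1, hRN⟩ := hAU.exists_minimizesRegret hbest
  obtain ⟨P, hP, hreg, hPN⟩ := hN.exists_weightedSet hN1
  have hB := hAU.menusBounded
  obtain ⟨l₀, l₁, hl⟩ := hAU.exists_lt
  have hU := exists_ne_of_util_lt hl
  have hR : MinimizesRegret 𝓜 (T univ) U (upperExp P) := fun M hM f hf g hg => by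
    rw [hPN _ (regret_nonneg (hB.utilBounded hM) hf), hPN _ (regret_nonneg (hB.utilBounded hM) hg)]
    exact hRN M hM f hf g hg
  refine ⟨U, P, hP, hreg, hT.represents h𝓜 hU hB hP hR, fun a b ha => ?_, fun V Q hQ hVQ => ?_⟩
  · refine hT.represents h𝓜 ?_ (hB.affine ha b) hP
      ((MinimizesRegret.affine_iff hP.isUpperExpectation h𝓜 hB ha b).2 hR)
    obtain ⟨y₁, y₂, hy⟩ := hU
    exact ⟨y₁, y₂, by simpa [ha.ne'] using hy⟩
  · have hRQ := hVQ.minimizesRegret hQ hA.nonNull_univ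
    -- U and V represent the same preferences over constant acts.
    obtain ⟨a, b, ha, rfl⟩ := exists_affine_of_util_le_iff (V := V) hl fun l l' => by
      rw [← hAU.constPref_iff, hRQ.constPref_iff hQ.isUpperExpectation h𝓜]
    refine ⟨⟨a, b, ha, rfl⟩, fun hQreg => ?_⟩
    rw [MinimizesRegret.affine_iff hQ.isUpperExpectation h𝓜 hB ha b] at hRQ
    rw [hQ.subProbs_eq_dominated hQreg, hP.subProbs_eq_dominated hreg]
    have := fun v hv => hRQ.eq_of_one h𝓜 ⟨l₀, l₁, hl⟩ hR hQ.isUpperExpectation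
      hP.isUpperExpectation hQ.upperExp_one hP.upperExp_one (v := v) hv
    ext q
    -- Equal upper expectations dominate the same sub-probabilities.
    exact and_congr_right fun _ => forall₂_congr fun v hv => by rw [this v hv]

end

end MWER

end

theorem theorem2 {S Y : Type*} [Fintype S]
    (𝓜 : Set (Set (MWER.Act S Y))) (h𝓜 : MWER.IsMenuCollection 𝓜) :
    -- MWER preferences with likelihood updating satisfy the axioms
    (∀ (U : Y → ℝ) (P : Set ((S → ℝ) × ℝ)),
      (∃ y₁ y₂, U y₁ ≠ U y₂) → MWER.IsWeightedSet P → MWER.MenusBounded 𝓜 U →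
        (∀ E : Set S,
          MWER.NonNull 𝓜 (MWER.mwerCondPref U P Set.univ) E ↔ 0 < MWER.upperLik P E) ∧
        (∀ E : Set S, 0 < MWER.upperLik P E →
          MWER.Axioms 𝓜 (MWER.mwerCondPref U P E) ∧
          MWER.LimitINA 𝓜 (MWER.mwerCondPref U P E)) ∧
        MWER.MDC 𝓜 (MWER.mwerCondPref U P) ∧
        (∀ M ∈ 𝓜, ∀ f ∈ M, ∀ g ∈ M,
          (MWER.mwerCondPref U P Set.univ M f g ↔ MWER.mwerPref U P M f g))) ∧
    -- conversely, the axioms give a representation, which is unique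
    (∀ R : MWER.CondPref S Y,
      (∀ E : Set S, E = Set.univ ∨ MWER.NonNull 𝓜 (R Set.univ) E → MWER.Axioms 𝓜 (R E)) →
      MWER.MDC 𝓜 R →
      ((∀ M ∈ 𝓜, MWER.HasBestOutcomes (R Set.univ) M) ∨ MWER.LimitINA 𝓜 (R Set.univ)) →
        ∃ (U : Y → ℝ) (P : Set ((S → ℝ) × ℝ)),
          MWER.IsWeightedSet P ∧ MWER.IsRegular (MWER.subProbs P) ∧
          MWER.Represents 𝓜 R U P ∧
          (∀ a b : ℝ, 0 < a → MWER.Represents 𝓜 R (fun y => a * U y + b) P) ∧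
          (∀ (V : Y → ℝ) (Q : Set ((S → ℝ) × ℝ)),
            MWER.IsWeightedSet Q → MWER.Represents 𝓜 R V Q →
              (∃ a b : ℝ, 0 < a ∧ V = fun y => a * U y + b) ∧
              (MWER.IsRegular (MWER.subProbs Q) → MWER.subProbs Q = MWER.subProbs P))) := by
  refine ⟨fun U P hU hP hB => ?_, fun R hA hT hbest =>
    MWER.exists_represents h𝓜 (hA univ (.inl rfl)) hT hbest⟩
  refine ⟨fun E => ?_, fun E hE => ?_, MWER.mdc_mwerCondPref h𝓜 hU hP hB, fun M hM f hf g hg => ?_⟩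
  · rw [(hP.minimizesRegret_univ hB).nonNull_iff hP.isUpperExpectation h𝓜 hU hB, MWER.upperLik_eq]
  · have hR := hP.minimizesRegret_update hB hE
    exact ⟨hR.axioms (hP.isUpperExpectation_update hE) h𝓜 hU hB,
      hR.limitINA (hP.isUpperExpectation_update hE) h𝓜 hB⟩
  · exact hP.minimizesRegret_univ hB M hM f hf g hg
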